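/- Let $r,m\ge 1$, $n=r+m$, $\alpha,\beta\in\mathbb C$, and let $$A=\begin{bmatrix}\alpha I_r & C\\ D&\beta I_m\end{bmatrix}\in M_n(\mathbb C),\qquad C\in\mathbb C^{r\times m},\ D\in\mathbb C^{m\times r}.$$ For $1\le k\le n$ let $\Lambda_k(A)$ be the set of $\lambda\in\mathbb C$ such that $PAP=\lambda P$ for some orthogonal projection $P\in M_n(\mathbb C)$ of rank $k$, and let $W(A)=\{x^*Ax : x\in\mathbb C^n,\ x^*x=1\}$. For $s\ge 0$ let $E(\alpha,\beta;s)$ be the closed elliptical disc with foci $\alpha,\beta$ and minor axis of length $s$, that is, $\{z\in\mathbb C: |z-\alpha|+|z-\beta|\le\sqrt{|\alpha-\beta|^2+s^2}\}$ (the closed disc with centre $\alpha$ and radius $s/2$ if $\alpha=\beta$; the segment $[\alpha,\beta]$ if $s=0$). Assume that one of the following holds: - for some $\nu\subseteq\{1,\dots,r\}$, the $i$-th row of $C$ is zero for all $i\in\nu$ and the $j$-th column of $D$ is zero for all $j\in\{1,\dots,r\}\setminus\nu$ (so that $DC=0$); or - for some $\nu\subseteq\{1,\dots,m\}$, the $i$-th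 column of $C$ is zero for all $i\in\nu$ and the $j$-th row of $D$ is zero for all $j\in\{1,\dots,m\}\setminus\nu$ (so that $CD=0$). Let $p=\operatorname{rank}(C+D^*)$ and let $s_1\ge\dots\ge s_p$ be the nonzero singular values of $C+D^*$, counted with multiplicity. Then $$\Lambda_k(A)=E(\alpha,\beta;s_k)\quad\text{for } 1\le k\le p,\qquad\text{and}\qquad W(A)=E(\alpha,\beta;\|C+D^*\|),$$ where $\|\cdot\|$ is the spectral norm. For $p<k\le n$: - if $p<k\le\min\{r,m\}$, then $\Lambda_k(A)=[\alpha,\beta]$; - if $m<k\le r$, then $\Lambda_k(A)=\{\alpha\}$; if $r<k\le m$, then $\Lambda_k(A)=\{\beta\}$; - if $\max\{r,m\}<k\le n$, then $\Lambda_k(A)=\emptyset$, except that $\Lambda_k(A)=\{\alpha\}$ when $\alpha=\beta$ and $k\le n-p$. -/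

import Mathlib

open scoped Matrix
open scoped Matrix.Norms.L2Operator

namespace HigherRank

/-- The rank-`k` numerical range of a square complex matrix `A`: all `z` with `P A P = z P`
for some orthogonal projection `P` of rank `k`. -/
def rankNumericalRange {ι : Type*} [Fintype ι] [DecidableEq ι] (k : ℕ) (A : Matrix ι ι ℂ) :
    Set ℂ :=
  {z | ∃ P : Matrix ι ι ℂ, IsStarProjection P ∧ P.rank = k ∧ P * A * P = z • P}

/-- The classical numerical range: all `⟨A x, x⟩ = x^* A x` with `⟨x, x⟩ = x^* x = 1`. -/
def numericalRange {ι : Type*} [Fintype ι] (A : Matrix ι ι ℂ) : Set ℂ :=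
  {z | ∃ x : ι → ℂ, star x ⬝ᵥ x = 1 ∧ z = star x ⬝ᵥ (A *ᵥ x)}

/-- The block matrix with diagonal blocks `α I_r`, `β I_m` and off-diagonal blocks `C`
(upper right) and `D` (lower left). Its order is `n = r + m`. -/
def blockMatrix {r m : ℕ} (α β : ℂ) (C : Matrix (Fin r) (Fin m) ℂ)
    (D : Matrix (Fin m) (Fin r) ℂ) : Matrix (Fin r ⊕ Fin m) (Fin r ⊕ Fin m) ℂ :=
  Matrix.fromBlocks (α • (1 : Matrix (Fin r) (Fin r) ℂ)) C D
    (β • (1 : Matrix (Fin m) (Fin m) ℂ))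

/-- The closed elliptical disc with foci `α`, `β` and minor axis of length `s ≥ 0`: the sum of the
distances to the foci is at most the length `√(|α - β|² + s²)` of the major axis.
For `α = β` it is the closed disc about `α` of radius `s / 2`; for `s = 0` it is the
segment `[α, β]`. -/
def ellipticalDisc (α β : ℂ) (s : ℝ) : Set ℂ :=
  {z | ‖z - α‖ + ‖z - β‖ ≤ √(‖α - β‖ ^ 2 + s ^ 2)}

/-- `singularValue N k` is the `k`-th largest singular value of `N`, `k = 1, 2, …`, counting
multiplicities. (Mathlib's sequence of singular values starts at index `0`.) -/
noncomputable def singularValue {r m : ℕ} (N : Matrix (Fin r) (Fin m) ℂ) (k : ℕ) : ℝ :=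
  (Matrix.toEuclideanLin N).singularValues (k - 1)

/-- For some set `ν` of indices in `{1, …, r}`, the rows of `C` indexed by `ν` and the columns
of `D` indexed by the complement of `ν` vanish. -/
def RowPattern {r m : ℕ} (C : Matrix (Fin r) (Fin m) ℂ) (D : Matrix (Fin m) (Fin r) ℂ) : Prop :=
  ∃ ν : Set (Fin r), (∀ i ∈ ν, ∀ j, C i j = 0) ∧ (∀ i ∉ ν, ∀ j, D j i = 0)

/-- For some set `ν` of indices in `{1, …, m}`, the columns of `C` indexed by `ν` and the rows
of `D` indexed by the complement of `ν` vanish. -/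
def ColumnPattern {r m : ℕ} (C : Matrix (Fin r) (Fin m) ℂ) (D : Matrix (Fin m) (Fin r) ℂ) :
    Prop :=
  ∃ ν : Set (Fin m), (∀ j ∈ ν, ∀ i, C i j = 0) ∧ (∀ j ∉ ν, ∀ i, D j i = 0)

end HigherRank

/-! Write a = α - z, b = β - z, N = C + D*. Then z lies in Λ_k(A) exactly when the sesquilinear form
of A - z vanishes identically on some k-dimensional subspace
(`mem_rankNumericalRange_blockMatrix_iff`), and z lies in E(α, β; s) exactly when `discrepancy a b`
≤ s². The row pattern says C = (1 - F)N and D = N*F for a projection F; the column pattern is the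
same with the two summands exchanged. Hence for |c| = 1 twice the Hermitian part of c(A - z) has
scalar diagonal blocks 2 Re(ca), 2 Re(cb) and off-diagonal block cC + c̄D*. This block is N
multiplied on one side by a unitary, so its singular values do not depend on c.

Upper bound (`HasIsotropic.discrepancy_le`): choose c with 4 Re(ca) Re(cb) maximal, that is, equal
to the discrepancy. If this exceeded s_k², the Hermitian part would be positive definite on a
subspace of codimension less than k, which every isotropic k-space meets.

Lower bound (`hasIsotropic_of_discrepancy_lt`, `exists_isotropic_of_pencil`): when the discrepancy
is strictly smaller, all rotated Hermitian parts are nonsingular except, up to real multiples, the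
one with Re(ca) = 0. The operator comparing this one with the part rotated by i has no nonzero real
eigenvalue. Its spectral subspaces for the open upper and lower half-planes are totally isotropic,
and their dimensions add up to enough for one of them to have dimension k. Boundary points and the
segment [α, β] follow by closedness of Λ_k, in z and in A respectively.

For k > m an isotropic subspace forces a = 0, for k > r it forces b = 0. If both vanish, comparing
an isotropic subspace with its orthogonal complement gives k ≤ n - p, and U × ker N attains this
bound. -/

namespace HigherRank

open Module InnerProductSpace

/-! ### Isotropic subspaces from a pencil of Hermitian forms -/

section Isotropic

variable {W : Type*} [NormedAddCommGroup W] [InnerProductSpace ℂ W]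

/-- If `B` is self-adjoint for the Hermitian form of `H`, then its generalized eigenspaces at
`a` and `b` are orthogonal for that form unless `b` is the conjugate of `a`. -/
theorem inner_eq_zero_of_mem_maxGenEigenspace [FiniteDimensional ℂ W] {H B : End ℂ W}
    (hHB : ∀ x y, inner ℂ (B x) (H y) = inner ℂ x (H (B y))) {a b : ℂ} (hab : star a ≠ b)
    {x y : W} (hx : x ∈ B.maxGenEigenspace a) (hy : y ∈ B.maxGenEigenspace b) :
    inner ℂ x (H y) = 0 := by
  obtain ⟨n, hn⟩ := (End.mem_maxGenEigenspace B a x).1 hx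
  clear hx
  induction n generalizing x y with
  | zero => simp_all
  | succ n ih =>
    -- Since b ≠ ā, B - ā is bijective on the generalized eigenspace of b. Writing y = (B - ā)y'
    -- moves a factor B - a onto x, which lowers its nilpotency order.
    have hmaps : ∀ w ∈ B.maxGenEigenspace b, (B - star a • (1 : End ℂ W)) w ∈
        B.maxGenEigenspace b := by
      intro w hw
      refine End.mapsTo_maxGenEigenspace_of_comm (f := B) (g := B - star a • (1 : End ℂ W)) ?_ b hw
      exact (Commute.refl B).sub_right ((Commute.one_right B).smul_right _)
    have hinj : Function.Injective ((B - star a • (1 : End ℂ W)).restrict hmaps) := by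
      rw [← LinearMap.ker_eq_bot, LinearMap.ker_eq_bot']
      rintro ⟨w, hw⟩ hw0
      have h0 : (B - star a • (1 : End ℂ W)) w = 0 := congrArg Subtype.val hw0
      have h1 : w ∈ B.maxGenEigenspace (star a) := by
        rw [End.mem_maxGenEigenspace]
        exact ⟨1, by simpa using h0⟩
      have hdis := End.disjoint_genEigenspace B hab ⊤ ⊤
      have := Submodule.disjoint_def.1 hdis w h1 hw
      simpa using this
    obtain ⟨⟨y', hy'⟩, hyy⟩ := (LinearMap.injective_iff_surjective.1 hinj) ⟨y, hy⟩
    have hyy : (B - star a • (1 : End ℂ W)) y' = y := congrArg Subtype.val hyy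
    have key : inner ℂ ((B - a • (1 : End ℂ W)) x) (H y') = 0 := by
      refine ih hy' ?_
      rw [← hn, pow_succ, End.mul_apply]
    rw [← hyy]
    simp only [LinearMap.sub_apply, LinearMap.smul_apply, End.one_apply, map_sub, map_smul,
      inner_sub_left, inner_sub_right, inner_smul_left, inner_smul_right, hHB] at key ⊢
    exact key

theorem inner_eq_zero_of_mem_iSup {ι : Type*} {p q : ι → Submodule ℂ W} {H : End ℂ W}
    (h : ∀ i j, ∀ x ∈ p i, ∀ y ∈ q j, inner ℂ x (H y) = 0) {x y : W}
    (hx : x ∈ ⨆ i, p i) (hy : y ∈ ⨆ i, q i) : inner ℂ x (H y) = 0 := by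
  refine Submodule.iSup_induction p (motive := fun x => inner ℂ x (H y) = 0) hx ?_ (by simp)
    (fun x₁ x₂ h₁ h₂ => by rw [inner_add_left, h₁, h₂, add_zero])
  intro i x hx
  refine Submodule.iSup_induction q (motive := fun y => inner ℂ x (H y) = 0) hy ?_ (by simp)
    (fun y₁ y₂ h₁ h₂ => by rw [map_add, inner_add_right, h₁, h₂, add_zero])
  exact fun j y hy => h i j x hx y hy

theorem exists_le_finrank_eq {V : Type*} [AddCommGroup V] [Module ℂ V] [FiniteDimensional ℂ V]
    (M : Submodule ℂ V) {k : ℕ} (hk : k ≤ finrank ℂ M) :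
    ∃ L ≤ M, finrank ℂ L = k := by
  obtain ⟨f, hf⟩ := exists_linearIndependent_of_le_finrank (R := ℂ) (M := M) hk
  refine ⟨(Submodule.span ℂ (Set.range f)).map M.subtype, Submodule.map_subtype_le _ _, ?_⟩
  rw [(Submodule.equivSubtypeMap M _).finrank_eq.symm, finrank_span_eq_card hf, Fintype.card_fin]

/-- If ker B² = ker B, the kernels of all higher powers coincide with ker B as well. -/
theorem apply_eq_zero_of_mem_maxGenEigenspace_zero {B : End ℂ W}
    (hB : ∀ x, B (B x) = 0 → B x = 0) {x : W} (hx : x ∈ B.maxGenEigenspace 0) : B x = 0 := by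
  obtain ⟨n, hn⟩ := (End.mem_maxGenEigenspace B 0 x).1 hx
  rw [zero_smul, sub_zero] at hn
  clear hx
  induction n with
  | zero =>
    rw [pow_zero, End.one_apply] at hn
    rw [hn, map_zero]
  | succ n ih =>
    rcases n with _ | n
    · simpa using hn
    · apply ih
      rw [pow_succ', End.mul_apply] at hn ⊢
      rw [pow_succ', End.mul_apply] at hn
      exact hB _ hn

theorem maxGenEigenspace_eq_bot_of_eigenspace_eq_bot {B : End ℂ W} {t : ℂ}
    (hbot : B.eigenspace t = ⊥) : B.maxGenEigenspace t = ⊥ := by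
  rw [eq_bot_iff]
  intro x hx
  obtain ⟨n, hn⟩ := (End.mem_maxGenEigenspace B t x).1 hx
  have hinj : Function.Injective (B - t • (1 : End ℂ W)) := by
    rw [← LinearMap.ker_eq_bot, ← hbot]
    exact End.eigenspace_def.symm
  have : Function.Injective ((B - t • (1 : End ℂ W)) ^ n) := by
    rw [End.coe_pow]; exact hinj.iterate n
  exact this (by rw [hn, map_zero])

/-- A sesquilinear form `⟪x, T y⟫` all of whose rotated Hermitian parts except one are
nondegenerate has a totally isotropic subspace of half the dimension of the complement of the
kernel of the exceptional one, provided that the form is definite on that kernel. -/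
theorem exists_isotropic_of_pencil [FiniteDimensional ℂ W] {T S : End ℂ W}
    (hTS : ∀ x y, inner ℂ x (T y) = inner ℂ (S x) y) {k : ℕ}
    (hreg : ∀ c : ℂ, c.im ≠ 0 → ∀ x, c • T x + star c • S x = 0 → x = 0)
    (hdef : ∀ x, T x + S x = 0 → inner ℂ x (T x) = 0 → x = 0)
    (hdim : finrank ℂ (LinearMap.ker (T + S)) + 2 * k ≤ finrank ℂ W) :
    ∃ L : Submodule ℂ W, finrank ℂ L = k ∧ ∀ x ∈ L, ∀ y ∈ L, inner ℂ x (T y) = 0 := by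
  have hST : ∀ x y, inner ℂ x (S y) = inner ℂ (T x) y := fun x y => by
    rw [← inner_conj_symm, ← hTS, inner_conj_symm]
  -- H is twice the Hermitian part of iT, invertible by `hreg` at c = i; the operator to study is B
  -- = H⁻¹(T + S).
  set H : End ℂ W := Complex.I • (T - S) with hH
  have hHinj : Function.Injective H := by
    rw [← LinearMap.ker_eq_bot, LinearMap.ker_eq_bot']
    intro x hx
    refine hreg Complex.I (by simp) x ?_
    simpa [hH, smul_sub, sub_eq_add_neg] using hx
  obtain ⟨B, hHB'⟩ : ∃ B : End ℂ W, ∀ x, H (B x) = T x + S x :=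
    ⟨(LinearEquiv.ofInjectiveEndo H hHinj).symm.toLinearMap ∘ₗ (T + S), fun x =>
      (LinearEquiv.ofInjectiveEndo H hHinj).apply_symm_apply ((T + S) x)⟩
  have hHsymm : ∀ x y, inner ℂ (H x) y = inner ℂ x (H y) := fun x y => by
    simp only [hH, LinearMap.smul_apply, LinearMap.sub_apply, inner_smul_left, inner_smul_right,
      inner_sub_left, inner_sub_right, hTS, hST, Complex.conj_I]
    ring
  have hHB : ∀ x y, inner ℂ (B x) (H y) = inner ℂ x (H (B y)) := fun x y => by
    rw [← hHsymm, hHB', hHB', inner_add_left, inner_add_right, hTS, hST, add_comm]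
  -- A vector Bx in ker B lies in ker(T + S) and is null for H. On that kernel H = 2iT, so
  -- definiteness forces Bx = 0.
  have hBker : ∀ x, B (B x) = 0 → B x = 0 := fun x hx => by
    refine hdef _ ?_ ?_
    · rw [← hHB', hx, map_zero]
    · have h1 : T (B x) + S (B x) = 0 := by rw [← hHB', hx, map_zero]
      have h2 : inner ℂ (B x) (H (B x)) = 0 := by rw [hHB, hx, map_zero, inner_zero_right]
      rw [hH, LinearMap.smul_apply, LinearMap.sub_apply, ← neg_eq_of_add_eq_zero_right h1,
        sub_neg_eq_add, inner_smul_right, inner_add_right] at h2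
      have := (mul_eq_zero.1 h2).resolve_left Complex.I_ne_zero
      linear_combination (1 / 2 : ℂ) * this
  have hK : B.maxGenEigenspace 0 ≤ LinearMap.ker (T + S) := by
    intro x hx
    have := apply_eq_zero_of_mem_maxGenEigenspace_zero hBker hx
    rw [LinearMap.mem_ker, LinearMap.add_apply, ← hHB', this, map_zero]
  -- An eigenvector for a real t is killed by cT + c̄S with c = 1 - it, which is not real when t ≠
  -- 0.
  have hreal : ∀ t : ℂ, t.im = 0 → t ≠ 0 → B.maxGenEigenspace t = ⊥ := by
    intro t ht ht0
    by_contra hne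
    have hev : B.HasEigenvalue t := fun h => hne (maxGenEigenspace_eq_bot_of_eigenspace_eq_bot h)
    obtain ⟨x, hx⟩ := hev.exists_hasEigenvector
    apply hx.2
    have h1 := hHB' x
    rw [hx.apply_eq_smul, map_smul] at h1
    have htr : star t = t := Complex.conj_eq_iff_im.2 ht
    refine hreg (1 - t * Complex.I) ?_ x ?_
    · have : t.re ≠ 0 := fun h => ht0 (Complex.ext h ht)
      simpa using this
    · have hst : star (1 - t * Complex.I) = 1 + t * Complex.I := by
        rw [star_sub, star_mul, htr]; simp [mul_comm]
      rw [hst]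
      simp only [hH, LinearMap.smul_apply, LinearMap.sub_apply] at h1
      linear_combination (norm := module) -h1
  -- Neither open half-plane contains a number together with its conjugate, so both sums are
  -- isotropic for H.
  set Vp : Submodule ℂ W := ⨆ t : {t : ℂ // 0 < t.im}, B.maxGenEigenspace t.1
  set Vm : Submodule ℂ W := ⨆ t : {t : ℂ // t.im < 0}, B.maxGenEigenspace t.1
  have htop : Vp ⊔ Vm ⊔ LinearMap.ker (T + S) = ⊤ := by
    rw [eq_top_iff, ← End.iSup_maxGenEigenspace_eq_top B]
    refine iSup_le fun t => ?_
    rcases lt_trichotomy t.im 0 with h | h | h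
    · exact le_sup_of_le_left (le_sup_of_le_right
        (le_iSup (fun t : {t : ℂ // t.im < 0} => B.maxGenEigenspace t.1) ⟨t, h⟩))
    · by_cases h0 : t = 0
      · exact le_sup_of_le_right (h0 ▸ hK)
      · rw [hreal t h h0]; exact bot_le
    · exact le_sup_of_le_left (le_sup_of_le_left
        (le_iSup (fun t : {t : ℂ // 0 < t.im} => B.maxGenEigenspace t.1) ⟨t, h⟩))
  have hsum : 2 * k ≤ finrank ℂ Vp + finrank ℂ Vm := by
    have h1 := Submodule.finrank_add_le_finrank_add_finrank (Vp ⊔ Vm) (LinearMap.ker (T + S))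
    have h2 := Submodule.finrank_add_le_finrank_add_finrank Vp Vm
    rw [htop, finrank_top] at h1
    omega
  -- On a B-invariant H-isotropic subspace the form of HB = T + S vanishes too, and T is a
  -- combination of T + S and T - S.
  have fin : ∀ V : Submodule ℂ W, k ≤ finrank ℂ V →
      (∀ x ∈ V, ∀ y ∈ V, inner ℂ x (H y) = 0) → (∀ x ∈ V, B x ∈ V) →
      ∃ L : Submodule ℂ W, finrank ℂ L = k ∧ ∀ x ∈ L, ∀ y ∈ L, inner ℂ x (T y) = 0 := by
    intro V hV hiso hinv
    obtain ⟨L, hLV, hL⟩ := exists_le_finrank_eq V hV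
    refine ⟨L, hL, fun x hx y hy => ?_⟩
    have h1 := hiso x (hLV hx) y (hLV hy)
    have h2 := hiso x (hLV hx) _ (hinv y (hLV hy))
    rw [hHB', inner_add_right] at h2
    simp only [hH, LinearMap.smul_apply, LinearMap.sub_apply, inner_smul_right,
      inner_sub_right] at h1
    have h3 := (mul_eq_zero.1 h1).resolve_left Complex.I_ne_zero
    linear_combination (1 / 2 : ℂ) * (h2 + h3)
  have hinvsup : ∀ (P : ℂ → Prop) (x : W), x ∈ ⨆ t : {t : ℂ // P t}, B.maxGenEigenspace t.1 →
      B x ∈ ⨆ t : {t : ℂ // P t}, B.maxGenEigenspace t.1 := by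
    intro P x hx
    refine Submodule.iSup_induction _
      (motive := fun x => B x ∈ ⨆ t : {t : ℂ // P t}, B.maxGenEigenspace t.1) hx ?_ (by simp)
      (fun x y hx hy => by rw [map_add]; exact add_mem hx hy)
    intro t x hx
    exact le_iSup (fun t : {t : ℂ // P t} => B.maxGenEigenspace t.1) t
      (End.mapsTo_maxGenEigenspace_of_comm (Commute.refl B) t.1 hx)
  rcases le_or_gt k (finrank ℂ Vp) with h | h
  · refine fin Vp h (fun x hx y hy => inner_eq_zero_of_mem_iSup ?_ hx hy) (hinvsup _)
    intro s t x hx y hy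
    refine inner_eq_zero_of_mem_maxGenEigenspace hHB ?_ hx hy
    intro hst
    have := congrArg Complex.im hst
    have h1 := s.2
    have h2 := t.2
    simp at this
    linarith
  · refine fin Vm (by omega) (fun x hx y hy => inner_eq_zero_of_mem_iSup ?_ hx hy) (hinvsup _)
    intro s t x hx y hy
    refine inner_eq_zero_of_mem_maxGenEigenspace hHB ?_ hx hy
    intro hst
    have := congrArg Complex.im hst
    have h1 := s.2
    have h2 := t.2
    simp at this
    linarith

end Isotropic

end HigherRank

namespace HigherRank

open Module InnerProductSpace

/-! ### Block forms, twists and the discrepancy -/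

section BlockForm

variable {U V : Type*} [NormedAddCommGroup U] [InnerProductSpace ℂ U]
  [NormedAddCommGroup V] [InnerProductSpace ℂ V]

/-- The sesquilinear form on `U × V` of the block operator with diagonal blocks `a`, `b` and
off-diagonal blocks `C`, `D`. -/
noncomputable def blockForm (a b : ℂ) (C : V →ₗ[ℂ] U) (D : U →ₗ[ℂ] V) (x y : U × V) : ℂ :=
  a * inner ℂ x.1 y.1 + b * inner ℂ x.2 y.2 + inner ℂ x.1 (C y.2) + inner ℂ x.2 (D y.1)

/-- The block form has a totally isotropic subspace of dimension `k`. -/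
def HasIsotropic (k : ℕ) (a b : ℂ) (C : V →ₗ[ℂ] U) (D : U →ₗ[ℂ] V) : Prop :=
  ∃ L : Submodule ℂ (U × V), finrank ℂ L = k ∧ ∀ x ∈ L, ∀ y ∈ L, blockForm a b C D x y = 0

theorem HasIsotropic.swap {k : ℕ} {a b : ℂ} {C : V →ₗ[ℂ] U} {D : U →ₗ[ℂ] V}
    (h : HasIsotropic k a b C D) : HasIsotropic k b a D C := by
  obtain ⟨L, hL, hiso⟩ := h
  refine ⟨L.map (LinearEquiv.prodComm ℂ U V).toLinearMap, ?_, ?_⟩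
  · rw [← hL]; exact LinearEquiv.finrank_map_eq _ _
  · rintro _ ⟨x, hx, rfl⟩ _ ⟨y, hy, rfl⟩
    have := hiso x hx y hy
    simp only [blockForm, LinearEquiv.coe_coe, LinearEquiv.prodComm_apply, Prod.fst_swap,
      Prod.snd_swap] at this ⊢
    linear_combination this

theorem HasIsotropic.of_le_finrank {k : ℕ} {a b : ℂ} {C : V →ₗ[ℂ] U} {D : U →ₗ[ℂ] V}
    [FiniteDimensional ℂ U] [FiniteDimensional ℂ V] {L : Submodule ℂ (U × V)}
    (hk : k ≤ finrank ℂ L) (hL : ∀ x ∈ L, ∀ y ∈ L, blockForm a b C D x y = 0) :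
    HasIsotropic k a b C D := by
  obtain ⟨M, hML, hM⟩ := exists_le_finrank_eq L hk
  exact ⟨M, hM, fun x hx y hy => hL x (hML hx) y (hML hy)⟩

theorem HasIsotropic.of_left_eq_zero {k : ℕ} {b : ℂ} {C : V →ₗ[ℂ] U} {D : U →ₗ[ℂ] V}
    [FiniteDimensional ℂ U] [FiniteDimensional ℂ V]
    (hk : k ≤ finrank ℂ U) : HasIsotropic k 0 b C D := by
  refine HasIsotropic.of_le_finrank (L := LinearMap.range (LinearMap.inl ℂ U V)) ?_ ?_
  · rwa [LinearMap.finrank_range_of_inj LinearMap.inl_injective]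
  · rintro _ ⟨x, rfl⟩ _ ⟨y, rfl⟩
    simp [blockForm]

/-- On vectors (u, 0) the form is a‖u‖². If a ≠ 0, an isotropic subspace therefore projects
injectively to V. -/
theorem HasIsotropic.left_eq_zero {k : ℕ} {a b : ℂ} {C : V →ₗ[ℂ] U} {D : U →ₗ[ℂ] V}
    [FiniteDimensional ℂ U] [FiniteDimensional ℂ V]
    (h : HasIsotropic k a b C D) (hk : finrank ℂ V < k) : a = 0 := by
  obtain ⟨L, hL, hiso⟩ := h
  by_contra ha
  have hinj : Function.Injective ((LinearMap.snd ℂ U V).domRestrict L) := by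
    rw [← LinearMap.ker_eq_bot, LinearMap.ker_eq_bot']
    rintro ⟨⟨u, v⟩, hx⟩ hv
    have hv : v = 0 := hv
    have h0 := hiso _ hx _ hx
    subst hv
    simp [blockForm, ha] at h0
    simp [h0]
  have := LinearMap.finrank_le_finrank_of_injective hinj
  omega

/-- Weights `c (1 - E) + c̄ E` for a projection `E`. -/
noncomputable def twist (E : U →ₗ[ℂ] U) (c : ℂ) : U →ₗ[ℂ] U :=
  c • (LinearMap.id - E) + star c • E

theorem twist_twist {E : U →ₗ[ℂ] U} (hE : ∀ u, E (E u) = E u) (c : ℂ) (u : U) :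
    twist E (star c) (twist E c u) = (star c * c) • u := by
  simp only [twist, LinearMap.add_apply, LinearMap.smul_apply, LinearMap.sub_apply,
    LinearMap.id_apply, map_add, map_smul, map_sub, hE, star_star]
  module

theorem inner_twist {E : U →ₗ[ℂ] U} (hE : E.IsSymmetric) (c : ℂ) (u w : U) :
    inner ℂ (twist E c u) w = inner ℂ u (twist E (star c) w) := by
  have h : inner ℂ (E u) w = inner ℂ u (E w) := hE u w
  simp [twist, h]
  ring

/-- For a symmetric idempotent E the adjoint of the twist by c is the twist by c̄, and their product
is |c|²: the twist is |c| times a unitary. -/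
theorem norm_twist {E : U →ₗ[ℂ] U} (hE : E.IsSymmetric) (hEE : ∀ u, E (E u) = E u) (c : ℂ)
    (u : U) : ‖twist E c u‖ = ‖c‖ * ‖u‖ := by
  have h : inner ℂ (twist E c u) (twist E c u) = ((‖c‖ * ‖u‖) ^ 2 : ℝ) := by
    rw [inner_twist hE, twist_twist hEE, inner_smul_right, inner_self_eq_norm_sq_to_K]
    have : star c * c = ((‖c‖ ^ 2 : ℝ) : ℂ) := by
      rw [mul_comm]; push_cast; exact Complex.mul_conj' c
    rw [this]; push_cast; simp; ring
  rw [inner_self_eq_norm_sq_to_K] at h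
  have h2 : ‖twist E c u‖ ^ 2 = (‖c‖ * ‖u‖) ^ 2 := by
    apply Complex.ofReal_injective
    rw [← h]; push_cast; rfl
  exact (sq_eq_sq₀ (norm_nonneg _) (by positivity)).1 h2

/-- The maximum of `4 Re (c a) Re (c b)` over all `c` of modulus one. -/
noncomputable def discrepancy (a b : ℂ) : ℝ := 2 * (‖a‖ * ‖b‖) + 2 * (a * star b).re

theorem discrepancy_nonneg (a b : ℂ) : 0 ≤ discrepancy a b := by
  have := (abs_le.1 (Complex.abs_re_le_norm (a * star b))).1
  rw [norm_mul, norm_star] at this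
  unfold discrepancy
  linarith

theorem discrepancy_comm (a b : ℂ) : discrepancy a b = discrepancy b a := by
  unfold discrepancy
  simp
  ring

theorem discrepancy_eq (a b : ℂ) : discrepancy a b = (‖a‖ + ‖b‖) ^ 2 - ‖a - b‖ ^ 2 := by
  have h := fun z : ℂ => (Complex.sq_norm z).trans (Complex.normSq_apply z)
  have h1 : (‖a‖ + ‖b‖) ^ 2 = ‖a‖ ^ 2 + ‖b‖ ^ 2 + 2 * (‖a‖ * ‖b‖) := by ring
  rw [h1, h, h, h, discrepancy]
  simp
  ring

theorem four_mul_re_mul_re (a b c : ℂ) :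
    4 * ((c * a).re * (c * b).re) = 2 * (c ^ 2 * (a * b)).re + ‖c‖ ^ 2 * (2 * (a * star b).re) := by
  rw [Complex.sq_norm, Complex.normSq_apply]
  simp [pow_two]
  ring

theorem four_mul_re_mul_re_le (a b c : ℂ) :
    4 * ((c * a).re * (c * b).re) ≤ ‖c‖ ^ 2 * discrepancy a b := by
  rw [four_mul_re_mul_re]
  have := Complex.re_le_norm (c ^ 2 * (a * b))
  rw [norm_mul, norm_mul, norm_pow] at this
  unfold discrepancy
  linarith

theorem exists_four_mul_re_mul_re_eq {a b : ℂ} (ha : a ≠ 0) (hb : b ≠ 0) :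
    ∃ c : ℂ, ‖c‖ = 1 ∧ 4 * ((c * a).re * (c * b).re) = discrepancy a b := by
  -- This c² rotates ab to |ab|, the case of equality in Re(c²ab) ≤ |ab|.
  obtain ⟨c, hc⟩ := IsAlgClosed.exists_pow_nat_eq (star (a * b) / (‖a * b‖ : ℂ)) two_pos
  have hab : (‖a * b‖ : ℂ) ≠ 0 := by simp [ha, hb]
  have hc1 : ‖c‖ = 1 := by
    have : ‖c‖ ^ 2 = 1 := by
      rw [← norm_pow, hc, norm_div, norm_star, Complex.norm_real, norm_norm]
      exact div_self (by simp [ha, hb])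
    exact (pow_eq_one_iff_of_nonneg (norm_nonneg _) two_ne_zero).1 this
  refine ⟨c, hc1, ?_⟩
  rw [four_mul_re_mul_re, hc1, hc]
  have : star (a * b) / (‖a * b‖ : ℂ) * (a * b) = ((‖a‖ * ‖b‖ : ℝ) : ℂ) := by
    rw [div_mul_eq_mul_div, div_eq_iff hab, ← norm_mul, mul_comm, ← pow_two]
    exact Complex.mul_conj' _
  rw [this, Complex.ofReal_re, discrepancy]
  ring

end BlockForm

end HigherRank

namespace HigherRank

open Module InnerProductSpace

/-! ### Existence of isotropic subspaces and the bound on the discrepancy -/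

section Bounds

variable {U V : Type*} [NormedAddCommGroup U] [InnerProductSpace ℂ U]
  [NormedAddCommGroup V] [InnerProductSpace ℂ V]

/-- The block operator with diagonal blocks `a`, `b` and off-diagonal blocks `C`, `D`. -/
noncomputable def blockOp (a b : ℂ) (C : V →ₗ[ℂ] U) (D : U →ₗ[ℂ] V) : End ℂ (WithLp 2 (U × V)) :=
  (WithLp.linearEquiv 2 ℂ (U × V)).symm.toLinearMap ∘ₗ
    LinearMap.prod (a • LinearMap.fst ℂ U V + C ∘ₗ LinearMap.snd ℂ U V)
      (b • LinearMap.snd ℂ U V + D ∘ₗ LinearMap.fst ℂ U V) ∘ₗ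
    (WithLp.linearEquiv 2 ℂ (U × V)).toLinearMap

@[simp]
theorem blockOp_fst (a b : ℂ) (C : V →ₗ[ℂ] U) (D : U →ₗ[ℂ] V) (x : WithLp 2 (U × V)) :
    (blockOp a b C D x).fst = a • x.fst + C x.snd := rfl

@[simp]
theorem blockOp_snd (a b : ℂ) (C : V →ₗ[ℂ] U) (D : U →ₗ[ℂ] V) (x : WithLp 2 (U × V)) :
    (blockOp a b C D x).snd = b • x.snd + D x.fst := rfl

theorem inner_blockOp (a b : ℂ) (C : V →ₗ[ℂ] U) (D : U →ₗ[ℂ] V) (x y : WithLp 2 (U × V)) :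
    inner ℂ x (blockOp a b C D y) = blockForm a b C D x.ofLp y.ofLp := by
  rw [WithLp.prod_inner_apply]
  simp only [blockForm, WithLp.ofLp_fst, WithLp.ofLp_snd, blockOp_fst, blockOp_snd,
    inner_add_right, inner_smul_right]
  ring

theorem re_smul_add_star_smul (c a : ℂ) (u : U) :
    c • a • u + star c • star a • u = ((2 * (c * a).re : ℝ) : ℂ) • u := by
  rw [smul_smul, smul_smul, ← add_smul, mul_comm (star c), ← star_mul]
  congr 1
  have := Complex.add_conj (c * a)
  rw [← this, mul_comm]
  rfl

theorem re_mul_inner_self (c d : ℂ) (u : U) :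
    (c * (d * inner ℂ u u)).re = (c * d).re * ‖u‖ ^ 2 := by
  have h : inner ℂ u u = ((‖u‖ ^ 2 : ℝ) : ℂ) := by
    rw [inner_self_eq_norm_sq_to_K]; push_cast; rfl
  rw [h, ← mul_assoc, Complex.re_mul_ofReal]

variable [FiniteDimensional ℂ U] [FiniteDimensional ℂ V]

theorem inner_blockOp_eq_inner_adjoint (a b : ℂ) (C : V →ₗ[ℂ] U) (D : U →ₗ[ℂ] V)
    (x y : WithLp 2 (U × V)) :
    inner ℂ x (blockOp a b C D y) =
      inner ℂ (blockOp (star a) (star b) D.adjoint C.adjoint x) y := by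
  simp only [WithLp.prod_inner_apply, WithLp.ofLp_fst, WithLp.ofLp_snd, blockOp_fst, blockOp_snd,
    inner_add_right, inner_smul_right, inner_add_left, inner_smul_left,
    LinearMap.adjoint_inner_left]
  simp
  ring

/-- If `discrepancy a b * ‖v‖ ^ 2 < ‖Y v‖ ^ 2` for all nonzero `v`, then the block form with
off-diagonal blocks `(1 - E) Y` and `Y^* E` has a totally isotropic subspace of the same dimension
as the second summand. -/
theorem hasIsotropic_of_discrepancy_lt {E : U →ₗ[ℂ] U} (hE : E.IsSymmetric)
    (hEE : ∀ u, E (E u) = E u) (Y : V →ₗ[ℂ] U) {a b : ℂ} (ha : a ≠ 0)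
    (hlt : ∀ v, v ≠ 0 → discrepancy a b * ‖v‖ ^ 2 < ‖Y v‖ ^ 2) :
    HasIsotropic (finrank ℂ V) a b ((LinearMap.id - E) ∘ₗ Y) (Y.adjoint ∘ₗ E) := by
  have hYinj : ∀ v, Y v = 0 → v = 0 := fun v hv => by
    by_contra h0
    have := hlt v h0
    rw [hv, norm_zero] at this
    have := mul_nonneg (discrepancy_nonneg a b) (sq_nonneg ‖v‖)
    linarith
  set C := (LinearMap.id - E) ∘ₗ Y with hC
  set D := Y.adjoint ∘ₗ E with hD
  have hEadj : E.adjoint = E := (LinearMap.isSymmetric_iff_isSelfAdjoint E).1 hE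
  have hCadj : C.adjoint = Y.adjoint ∘ₗ (LinearMap.id - E) := by
    rw [hC, LinearMap.adjoint_comp, map_sub, hEadj, LinearMap.adjoint_id]
  have hDadj : D.adjoint = E ∘ₗ Y := by
    rw [hD, LinearMap.adjoint_comp, hEadj, LinearMap.adjoint_adjoint]
  have hcomp : ∀ (c : ℂ) (x : WithLp 2 (U × V)),
      c • blockOp a b C D x + star c • blockOp (star a) (star b) D.adjoint C.adjoint x = 0 →
      ((2 * (c * a).re : ℝ) : ℂ) • x.fst + twist E c (Y x.snd) = 0 ∧
        ((2 * (c * b).re : ℝ) : ℂ) • x.snd + Y.adjoint (twist E (star c) x.fst) = 0 := by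
    intro c x hx
    have h1 := congrArg WithLp.fst hx
    have h2 := congrArg WithLp.snd hx
    simp only [WithLp.add_fst, WithLp.add_snd, WithLp.smul_fst, WithLp.smul_snd, blockOp_fst,
      blockOp_snd, WithLp.zero_fst, WithLp.zero_snd, hCadj, hDadj] at h1 h2
    constructor
    · rw [← h1, ← re_smul_add_star_smul, hC]
      simp only [twist, LinearMap.add_apply, LinearMap.smul_apply, LinearMap.sub_apply,
        LinearMap.id_apply, LinearMap.comp_apply]
      module
    · rw [← h2, ← re_smul_add_star_smul, hD]
      simp only [twist, LinearMap.add_apply, LinearMap.smul_apply, LinearMap.sub_apply,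
        LinearMap.id_apply, LinearMap.comp_apply, map_add, map_sub, map_smul, star_star]
      module
  have hsnd : ∀ (c : ℂ) (x : WithLp 2 (U × V)), c ≠ 0 →
      c • blockOp a b C D x + star c • blockOp (star a) (star b) D.adjoint C.adjoint x = 0 →
      x.snd = 0 := by
    intro c x hc hx
    obtain ⟨h1, h2⟩ := hcomp c x hx
    by_contra hv
    set p : ℝ := 2 * (c * a).re with hp
    set q : ℝ := 2 * (c * b).re with hq
    -- Eliminating the first component leaves pq v = |c|² Y*Y v; pairing with v then contradicts
    -- `hlt`, as pq ≤ |c|² times the discrepancy.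
    have h3 : ((p * q : ℝ) : ℂ) • x.snd = (star c * c) • Y.adjoint (Y x.snd) := by
      have e1 : (p : ℂ) • x.fst = -twist E c (Y x.snd) := eq_neg_of_add_eq_zero_left h1
      have e2 : (q : ℂ) • x.snd = -Y.adjoint (twist E (star c) x.fst) :=
        eq_neg_of_add_eq_zero_left h2
      rw [Complex.ofReal_mul, mul_smul, e2, smul_neg, ← map_smul, ← map_smul, e1, map_neg,
        twist_twist hEE, map_neg, neg_neg, map_smul]
    have h4 := congrArg (inner ℂ x.snd) h3
    rw [inner_smul_right, inner_smul_right, LinearMap.adjoint_inner_right,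
      inner_self_eq_norm_sq_to_K, inner_self_eq_norm_sq_to_K, mul_comm (star c)] at h4
    have hcc : c * star c = (‖c‖ : ℂ) ^ 2 := Complex.mul_conj' c
    rw [hcc] at h4
    have h5 : p * q * ‖x.snd‖ ^ 2 = ‖c‖ ^ 2 * ‖Y x.snd‖ ^ 2 := by
      apply Complex.ofReal_injective
      push_cast
      push_cast at h4
      exact h4
    have h6 := four_mul_re_mul_re_le a b c
    have h7 := hlt _ hv
    have h8 : 0 < ‖c‖ ^ 2 := by positivity
    have h9 : p * q ≤ ‖c‖ ^ 2 * discrepancy a b := by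
      rw [hp, hq]; linarith
    have h10 := mul_lt_mul_of_pos_left h7 h8
    have h11 := mul_le_mul_of_nonneg_right h9 (sq_nonneg ‖x.snd‖)
    linarith
  -- With this w, wa = i|a|², so Re(cwa) vanishes exactly for real c. The exceptional Hermitian part
  -- is then the one at c = 1.
  set w : ℂ := Complex.I * star a with hw
  have hw0 : w ≠ 0 := mul_ne_zero Complex.I_ne_zero (star_ne_zero.2 ha)
  have hwa : w * a = Complex.I * (‖a‖ ^ 2 : ℝ) := by
    rw [hw, mul_assoc, mul_comm (star a)]
    push_cast
    congr 1
    exact Complex.mul_conj' a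
  suffices h : ∃ L : Submodule ℂ (WithLp 2 (U × V)), finrank ℂ L = finrank ℂ V ∧
      ∀ x ∈ L, ∀ y ∈ L, inner ℂ x ((w • blockOp a b C D) y) = 0 by
    obtain ⟨L, hL, hiso⟩ := h
    refine ⟨L.map (WithLp.linearEquiv 2 ℂ (U × V)).toLinearMap, ?_, ?_⟩
    · rw [← hL]; exact LinearEquiv.finrank_map_eq _ _
    · rintro _ ⟨x, hx, rfl⟩ _ ⟨y, hy, rfl⟩
      have := hiso x hx y hy
      rw [LinearMap.smul_apply, inner_smul_right, inner_blockOp] at this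
      exact (mul_eq_zero.1 this).resolve_left hw0
  refine exists_isotropic_of_pencil
    (S := star w • blockOp (star a) (star b) D.adjoint C.adjoint) ?_ ?_ ?_ ?_
  · intro x y
    rw [LinearMap.smul_apply, LinearMap.smul_apply, inner_smul_right, inner_smul_left,
      inner_blockOp_eq_inner_adjoint]
    simp
  · intro c hc x hx
    have hx' : (c * w) • blockOp a b C D x +
        star (c * w) • blockOp (star a) (star b) D.adjoint C.adjoint x = 0 := by
      rw [← hx]
      simp only [LinearMap.smul_apply, star_mul]
      module
    have hc0 : c ≠ 0 := fun h => hc (by rw [h]; rfl)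
    have h2 := hsnd _ x (mul_ne_zero hc0 hw0) hx'
    have h1 := (hcomp _ x hx').1
    rw [h2, map_zero, map_zero, add_zero] at h1
    have h3 : ((2 * (c * w * a).re : ℝ) : ℂ) ≠ 0 := by
      rw [mul_assoc c, hwa, ← mul_assoc, Complex.re_mul_ofReal]
      simp [hc, ha]
    have h4 := (smul_eq_zero.1 h1).resolve_left h3
    exact WithLp.ofLp_injective 2 (Prod.ext h4 h2)
  · intro x hx hxx
    have h2 := hsnd w x hw0 hx
    rw [LinearMap.smul_apply, inner_smul_right, inner_blockOp] at hxx
    have hxx := (mul_eq_zero.1 hxx).resolve_left hw0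
    have h1 : x.fst = 0 := by simpa [blockForm, h2, ha] using hxx
    exact WithLp.ofLp_injective 2 (Prod.ext h1 h2)
  -- The exceptional kernel has zero V-component, and its U-component lies in ker G*. As G is
  -- injective, that has dimension dim U - dim V.
  · set G := twist E w ∘ₗ Y with hG
    have hGadj : ∀ u, G.adjoint u = Y.adjoint (twist E (star w) u) := by
      intro u
      refine ext_inner_left ℂ fun v => ?_
      rw [LinearMap.adjoint_inner_right, LinearMap.adjoint_inner_right, hG, LinearMap.comp_apply,
        inner_twist hE]
    have hGinj : Function.Injective G := by
      rw [← LinearMap.ker_eq_bot, LinearMap.ker_eq_bot']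
      intro v hv
      have h := norm_twist hE hEE w (Y v)
      rw [hG, LinearMap.comp_apply] at hv
      rw [hv, norm_zero] at h
      have := (mul_eq_zero.1 h.symm).resolve_left (by simpa using hw0)
      exact hYinj v (norm_eq_zero.1 this)
    have h1 : finrank ℂ (LinearMap.range G.adjoint) = finrank ℂ V := by
      rw [LinearMap.finrank_range_adjoint, LinearMap.finrank_range_of_inj hGinj]
    have h2 := G.adjoint.finrank_range_add_finrank_ker
    have h3 : finrank ℂ (WithLp 2 (U × V)) = finrank ℂ U + finrank ℂ V := by
      rw [(WithLp.linearEquiv 2 ℂ (U × V)).finrank_eq, finrank_prod]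
    set K := LinearMap.ker (w • blockOp a b C D +
      star w • blockOp (star a) (star b) D.adjoint C.adjoint)
    have h4 : finrank ℂ K ≤ finrank ℂ (LinearMap.ker G.adjoint) := by
      have hmem : ∀ x ∈ K, (LinearMap.fst ℂ U V ∘ₗ
          (WithLp.linearEquiv 2 ℂ (U × V)).toLinearMap) x ∈ LinearMap.ker G.adjoint := by
        intro x hx
        have h5 := (hcomp w x hx).2
        rw [hsnd w x hw0 hx, smul_zero, zero_add] at h5
        rw [LinearMap.mem_ker, hGadj]
        exact h5
      refine LinearMap.finrank_le_finrank_of_injective (f := LinearMap.restrict _ hmem) ?_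
      rw [← LinearMap.ker_eq_bot, LinearMap.ker_eq_bot']
      rintro ⟨x, hx⟩ h0
      have h6 : x.fst = 0 := congrArg Subtype.val h0
      exact Subtype.ext (WithLp.ofLp_injective 2 (Prod.ext h6 (hsnd w x hw0 hx)))
    omega

/-- A totally isotropic subspace of dimension `k` bounds the discrepancy of the diagonal entries
if the rotated off-diagonal blocks have norm at most `s` on subspaces of codimension `< k`. -/
theorem HasIsotropic.discrepancy_le {k : ℕ} {a b : ℂ} {C : V →ₗ[ℂ] U} {D : U →ₗ[ℂ] V} {s : ℝ}
    (h : HasIsotropic k a b C D)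
    (hS : ∀ c : ℂ, ‖c‖ = 1 → ∃ S : Submodule ℂ V, finrank ℂ V < finrank ℂ S + k ∧
      ∀ v ∈ S, ‖c • C v + star c • D.adjoint v‖ ≤ s * ‖v‖) :
    discrepancy a b ≤ s ^ 2 := by
  obtain ⟨L, hL, hiso⟩ := h
  by_contra! hlt
  have hpos : 0 < discrepancy a b := (sq_nonneg s).trans_lt hlt
  have ha : a ≠ 0 := by rintro rfl; simp [discrepancy] at hpos
  have hb : b ≠ 0 := by rintro rfl; simp [discrepancy] at hpos
  obtain ⟨c, hc1, hc⟩ : ∃ c : ℂ, ‖c‖ = 1 ∧ 0 < (c * a).re ∧ 0 < (c * b).re ∧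
      4 * ((c * a).re * (c * b).re) = discrepancy a b := by
    obtain ⟨c, hc1, hc⟩ := exists_four_mul_re_mul_re_eq ha hb
    have h0 : 0 < (c * a).re * (c * b).re := by linarith
    -- Only the product is known to be positive; replacing c by -c makes both factors positive.
    rcases mul_pos_iff.1 h0 with ⟨h1, h2⟩ | ⟨h1, h2⟩
    · exact ⟨c, hc1, h1, h2, hc⟩
    · refine ⟨-c, by rwa [norm_neg], ?_, ?_, ?_⟩ <;> simp only [neg_mul, Complex.neg_re] <;> linarith
  obtain ⟨hp, hq, hpq⟩ := hc
  obtain ⟨S, hSdim, hSle⟩ := hS c hc1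
  have hinj : Function.Injective ((LinearMap.snd ℂ U V).domRestrict L) := by
    rw [← LinearMap.ker_eq_bot, LinearMap.ker_eq_bot']
    rintro ⟨⟨u, v⟩, hx⟩ hv
    have hv : v = 0 := hv
    have h0 := hiso _ hx _ hx
    subst hv
    simp [blockForm, ha] at h0
    simp [h0]
  have hrange : finrank ℂ (LinearMap.range ((LinearMap.snd ℂ U V).domRestrict L)) = k := by
    rw [LinearMap.finrank_range_of_inj hinj, hL]
  have hne : LinearMap.range ((LinearMap.snd ℂ U V).domRestrict L) ⊓ S ≠ ⊥ := by
    intro hbot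
    have h1 := Submodule.finrank_sup_add_finrank_inf_eq
      (LinearMap.range ((LinearMap.snd ℂ U V).domRestrict L)) S
    rw [hbot, finrank_bot, hrange] at h1
    have := Submodule.finrank_le (LinearMap.range ((LinearMap.snd ℂ U V).domRestrict L) ⊔ S)
    omega
  obtain ⟨v, ⟨⟨⟨⟨u, v'⟩, hx⟩, rfl⟩, hvS⟩, hv0⟩ := Submodule.exists_mem_ne_zero_of_ne_bot hne
  have hvS : v' ∈ S := hvS
  have hv0 : v' ≠ 0 := hv0
  have h0 := hiso _ hx _ hx
  have h1 : (c * a).re * ‖u‖ ^ 2 + (c * b).re * ‖v'‖ ^ 2 +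
      (inner ℂ u (c • C v' + star c • D.adjoint v')).re = 0 := by
    have h2 := congrArg (fun z => (c * z).re) h0
    simp only [blockForm, mul_add, Complex.add_re, mul_zero, Complex.zero_re] at h2
    have hd : (c * inner ℂ v' (D u)).re = (star c * inner ℂ u (D.adjoint v')).re := by
      rw [LinearMap.adjoint_inner_right, ← inner_conj_symm v', ← Complex.conj_re (star c * _),
        map_mul]
      simp
    rw [re_mul_inner_self, re_mul_inner_self, hd] at h2
    rw [inner_add_right, inner_smul_right, inner_smul_right, Complex.add_re]
    linarith
  have h2 : -(‖u‖ * (s * ‖v'‖)) ≤ (inner ℂ u (c • C v' + star c • D.adjoint v')).re := by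
    have h3 := (abs_le.1 (Complex.abs_re_le_norm
      (inner ℂ u (c • C v' + star c • D.adjoint v')))).1
    have h4 := norm_inner_le_norm (𝕜 := ℂ) u (c • C v' + star c • D.adjoint v')
    have h5 := mul_le_mul_of_nonneg_left (hSle v' hvS) (norm_nonneg u)
    linarith
  set p := (c * a).re
  set q := (c * b).re
  have hv : 0 < ‖v'‖ := norm_pos_iff.2 hv0
  have h6 : p * ‖u‖ ^ 2 + q * ‖v'‖ ^ 2 - ‖u‖ * (s * ‖v'‖) ≤ 0 := by linarith
  -- Completing the square shows that the quadratic form is positive once 4pq > s² and v' ≠ 0.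
  have h7 : (2 * p * ‖u‖ - s * ‖v'‖) ^ 2 + (4 * (p * q) - s ^ 2) * ‖v'‖ ^ 2 =
      4 * p * (p * ‖u‖ ^ 2 + q * ‖v'‖ ^ 2 - ‖u‖ * (s * ‖v'‖)) := by ring
  have h8 : 0 < (4 * (p * q) - s ^ 2) * ‖v'‖ ^ 2 := mul_pos (by linarith) (by positivity)
  have h9 := mul_nonpos_of_nonneg_of_nonpos (by linarith : 0 ≤ 4 * p) h6
  nlinarith [sq_nonneg (2 * p * ‖u‖ - s * ‖v'‖)]

end Bounds

end HigherRank

namespace HigherRank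

open Module InnerProductSpace

/-! ### Singular values and extremal subspaces -/

section SingularValues

variable {U V : Type*} [NormedAddCommGroup U] [InnerProductSpace ℂ U] [FiniteDimensional ℂ U]
  [NormedAddCommGroup V] [InnerProductSpace ℂ V]

theorem inner_eq_zero_of_mem_span_range {n j : ℕ} (b : OrthonormalBasis (Fin n) ℂ V)
    {f : Fin j → Fin n} {v : V} (hv : v ∈ Submodule.span ℂ (Set.range (b ∘ f)))
    {i : Fin n} (hi : i ∉ Set.range f) : inner ℂ (b i) v = 0 := by
  induction hv using Submodule.span_induction with
  | mem x hx =>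
    obtain ⟨l, rfl⟩ := hx
    exact b.orthonormal.2 fun h => hi ⟨l, h.symm⟩
  | zero => exact inner_zero_right _
  | add x y _ _ hx hy => rw [inner_add_right, hx, hy, add_zero]
  | smul a x _ hx => rw [inner_smul_right, hx, mul_zero]

theorem finrank_span_range_comp {n j : ℕ} (b : OrthonormalBasis (Fin n) ℂ V)
    {f : Fin j → Fin n} (hf : Function.Injective f) :
    finrank ℂ (Submodule.span ℂ (Set.range (b ∘ f))) = j := by
  rw [finrank_span_eq_card (b.orthonormal.linearIndependent.comp f hf), Fintype.card_fin]

variable [FiniteDimensional ℂ V]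

/-- Expand ‖Nv‖² = ⟨v, N*Nv⟩ in an orthonormal eigenbasis of N*N. -/
theorem sum_sq_singularValues_mul (N : V →ₗ[ℂ] U) (v : V) :
    ‖N v‖ ^ 2 = ∑ i, N.singularValues (i : Fin (finrank ℂ V)) ^ 2 *
      ‖inner ℂ (N.isSymmetric_adjoint_comp_self.eigenvectorBasis rfl i) v‖ ^ 2 := by
  set hS := N.isSymmetric_adjoint_comp_self
  set b := hS.eigenvectorBasis rfl with hb
  have h1 : inner ℂ v ((N.adjoint ∘ₗ N) v) = ((‖N v‖ ^ 2 : ℝ) : ℂ) := by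
    rw [LinearMap.comp_apply, LinearMap.adjoint_inner_right, inner_self_eq_norm_sq_to_K]
    push_cast; rfl
  apply Complex.ofReal_injective
  rw [← h1, ← b.sum_inner_mul_inner]
  simp only [Complex.ofReal_sum, Complex.ofReal_mul, Complex.ofReal_pow]
  refine Finset.sum_congr rfl fun i _ => ?_
  rw [← hS (b i) v, hS.apply_eigenvectorBasis rfl i, inner_smul_left]
  have h2 := N.sq_singularValues_fin rfl i
  have h3 : inner ℂ v (b i) * inner ℂ (b i) v = (‖inner ℂ (b i) v‖ : ℂ) ^ 2 := by
    rw [← inner_conj_symm v]; exact Complex.conj_mul' _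
  rw [← hb, mul_left_comm, h3, ← Complex.ofReal_pow (N.singularValues _), h2]
  congr 1
  exact Complex.conj_ofReal _

/-- X is spanned by the first k right singular vectors. -/
theorem exists_finrank_eq_forall_singularValues_mul_le (N : V →ₗ[ℂ] U) {k : ℕ}
    (hk : k ≤ finrank ℂ V) :
    ∃ X : Submodule ℂ V, finrank ℂ X = k ∧
      ∀ v ∈ X, N.singularValues (k - 1) * ‖v‖ ≤ ‖N v‖ := by
  set b := N.isSymmetric_adjoint_comp_self.eigenvectorBasis rfl
  refine ⟨Submodule.span ℂ (Set.range (b ∘ Fin.castLE hk)),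
    finrank_span_range_comp b (Fin.castLE_injective hk), fun v hv => ?_⟩
  refine le_of_sq_le_sq ?_ (norm_nonneg _)
  rw [sum_sq_singularValues_mul, mul_pow, ← b.sum_sq_norm_inner_right, Finset.mul_sum]
  refine Finset.sum_le_sum fun i _ => ?_
  by_cases hi : i ∈ Set.range (Fin.castLE hk)
  · obtain ⟨l, rfl⟩ := hi
    refine mul_le_mul_of_nonneg_right ?_ (sq_nonneg _)
    exact pow_le_pow_left₀ (N.singularValues_nonneg _)
      (N.singularValues_antitone (by rw [Fin.val_castLE]; omega)) 2
  · rw [inner_eq_zero_of_mem_span_range b hv hi]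
    simp

/-- S is spanned by the right singular vectors from the k-th on, hence has codimension k - 1; for k
> dim V it is zero. -/
theorem exists_lt_finrank_forall_le_singularValues_mul (N : V →ₗ[ℂ] U) {k : ℕ} (hk : 1 ≤ k) :
    ∃ S : Submodule ℂ V, finrank ℂ V < finrank ℂ S + k ∧
      ∀ v ∈ S, ‖N v‖ ≤ N.singularValues (k - 1) * ‖v‖ := by
  rcases lt_or_ge (finrank ℂ V) k with h | h
  · refine ⟨⊥, by omega, fun v hv => ?_⟩
    rw [(Submodule.mem_bot ℂ).1 hv]
    simp
  set b := N.isSymmetric_adjoint_comp_self.eigenvectorBasis rfl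
  let f : Fin (finrank ℂ V - (k - 1)) → Fin (finrank ℂ V) := fun i => ⟨i + (k - 1), by omega⟩
  have hf : Function.Injective f := fun i j hij => by
    have := congrArg Fin.val hij
    simp only [f] at this
    omega
  refine ⟨Submodule.span ℂ (Set.range (b ∘ f)), ?_, fun v hv => ?_⟩
  · rw [finrank_span_range_comp b hf]; omega
  refine le_of_sq_le_sq ?_ (mul_nonneg (N.singularValues_nonneg _) (norm_nonneg _))
  rw [sum_sq_singularValues_mul, mul_pow, ← b.sum_sq_norm_inner_right, Finset.mul_sum]
  refine Finset.sum_le_sum fun i _ => ?_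
  by_cases hi : i ∈ Set.range f
  · obtain ⟨l, rfl⟩ := hi
    refine mul_le_mul_of_nonneg_right ?_ (sq_nonneg _)
    exact pow_le_pow_left₀ (N.singularValues_nonneg _)
      (N.singularValues_antitone (by simp [f])) 2
  · rw [inner_eq_zero_of_mem_span_range b hv hi]
    simp

/-- A lower bound for `N` on a subspace transfers to the adjoint of `N` on its image. -/
theorem exists_finrank_eq_forall_mul_le_adjoint {N : V →ₗ[ℂ] U} {X : Submodule ℂ V} {s : ℝ}
    (hs : 0 < s) (hX : ∀ v ∈ X, s * ‖v‖ ≤ ‖N v‖) :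
    finrank ℂ (X.map N) = finrank ℂ X ∧ ∀ u ∈ X.map N, s * ‖u‖ ≤ ‖N.adjoint u‖ := by
  constructor
  · have hinj : Function.Injective (N.domRestrict X) := by
      rw [← LinearMap.ker_eq_bot, LinearMap.ker_eq_bot']
      rintro ⟨v, hv⟩ h0
      have h1 := hX v hv
      have h0 : N v = 0 := h0
      rw [h0, norm_zero] at h1
      have : ‖v‖ ≤ 0 := by
        by_contra! h
        have := mul_pos hs h
        linarith
      exact Subtype.ext (norm_le_zero_iff.1 this)
    rw [← LinearMap.finrank_range_of_inj hinj, LinearMap.range_domRestrict]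
  · rintro _ ⟨v, hv, rfl⟩
    rcases eq_or_ne (N v) 0 with h0 | h0
    · simp [h0]
    -- Cauchy–Schwarz applied to ‖Nv‖² = ⟨v, N*Nv⟩.
    have h1 : ‖N v‖ ^ 2 ≤ ‖v‖ * ‖N.adjoint (N v)‖ := by
      have h2 := norm_inner_le_norm (𝕜 := ℂ) v (N.adjoint (N v))
      rw [LinearMap.adjoint_inner_right, inner_self_eq_norm_sq_to_K, norm_pow] at h2
      simpa using h2
    have h3 := hX v hv
    have h4 : 0 < ‖N v‖ := norm_pos_iff.2 h0
    refine le_of_mul_le_mul_left ?_ h4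
    calc ‖N v‖ * (s * ‖N v‖) = s * ‖N v‖ ^ 2 := by ring
      _ ≤ s * (‖v‖ * ‖N.adjoint (N v)‖) := mul_le_mul_of_nonneg_left h1 hs.le
      _ = (s * ‖v‖) * ‖N.adjoint (N v)‖ := by ring
      _ ≤ ‖N v‖ * ‖N.adjoint (N v)‖ := mul_le_mul_of_nonneg_right h3 (norm_nonneg _)

end SingularValues

/-! ### Vanishing diagonal blocks: the rank bound -/

section ZeroDiagonal

variable {U V : Type*} [NormedAddCommGroup U] [InnerProductSpace ℂ U] [FiniteDimensional ℂ U]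
  [NormedAddCommGroup V] [InnerProductSpace ℂ V] [FiniteDimensional ℂ V]

theorem finrank_submodule_prod (p : Submodule ℂ U) (q : Submodule ℂ V) :
    finrank ℂ (p.prod q) = finrank ℂ p + finrank ℂ q := by
  have hinj : Function.Injective (p.subtype.prodMap q.subtype) :=
    Function.Injective.prodMap p.injective_subtype q.injective_subtype
  rw [← finrank_prod, ← LinearMap.finrank_range_of_inj hinj, LinearMap.range_prodMap,
    Submodule.range_subtype, Submodule.range_subtype]

/-- Totally isotropic subspaces for vanishing diagonal blocks have codimension at least the rank
of `C + D^*`. -/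
theorem HasIsotropic.add_finrank_range_le {k : ℕ} {C : V →ₗ[ℂ] U} {D : U →ₗ[ℂ] V}
    (h : HasIsotropic k 0 0 C D) :
    k + finrank ℂ (LinearMap.range (C + D.adjoint)) ≤ finrank ℂ U + finrank ℂ V := by
  obtain ⟨L, hL, hiso⟩ := h
  set N := C + D.adjoint with hN
  have hNadj : ∀ u, N.adjoint u = C.adjoint u + D u := fun u => by
    rw [hN, map_add, LinearMap.adjoint_adjoint, LinearMap.add_apply]
  -- The Hermitian part of the form maps `L` into its annihilator.
  let e := WithLp.linearEquiv 2 ℂ (U × V)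
  let H : End ℂ (WithLp 2 (U × V)) := blockOp 0 0 N N.adjoint
  let M : Submodule ℂ (WithLp 2 (U × V)) := L.comap e.toLinearMap
  have hM : finrank ℂ M = k := by
    rw [← hL]
    have : M = L.map e.symm.toLinearMap := by
      ext x; simp [M, Submodule.mem_map_equiv]
    rw [this]
    exact LinearEquiv.finrank_map_eq _ _
  have horth : M.map H ≤ Mᗮ := by
    rintro _ ⟨y, hy, rfl⟩
    rw [Submodule.mem_orthogonal]
    intro x hx
    have h1 := hiso x.ofLp hx y.ofLp hy
    have h2 := congrArg star (hiso y.ofLp hy x.ofLp hx)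
    simp only [H, inner_blockOp]
    simp only [blockForm, zero_mul, zero_add, star_add, star_zero] at h1 h2 ⊢
    have h3 : star (inner ℂ y.ofLp.1 (C x.ofLp.2)) = inner ℂ x.ofLp.2 (C.adjoint y.ofLp.1) := by
      rw [LinearMap.adjoint_inner_right]; exact inner_conj_symm _ _
    have h4 : star (inner ℂ y.ofLp.2 (D x.ofLp.1)) = inner ℂ x.ofLp.1 (D.adjoint y.ofLp.2) := by
      rw [LinearMap.adjoint_inner_right]; exact inner_conj_symm _ _
    rw [h3, h4] at h2
    rw [hNadj, hN, LinearMap.add_apply, inner_add_right, inner_add_right]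
    linear_combination h1 + h2
  have hdim : finrank ℂ (WithLp 2 (U × V)) = finrank ℂ U + finrank ℂ V := by
    rw [e.finrank_eq, finrank_prod]
  have h1 : finrank ℂ M + finrank ℂ Mᗮ = _ := M.finrank_add_finrank_orthogonal
  have h2 := Submodule.finrank_mono horth
  -- With n = dim U + dim V and p = rank N: k - dim ker H ≤ dim H(M) ≤ n - k and dim ker H ≤ n - 2p,
  -- so k ≤ n - p.
  have h3 : finrank ℂ (M.map H) + finrank ℂ (LinearMap.ker H) ≥ finrank ℂ M := by
    have h4 := (H.domRestrict M).finrank_range_add_finrank_ker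
    rw [LinearMap.range_domRestrict] at h4
    have h5 : finrank ℂ (LinearMap.ker (H.domRestrict M)) ≤ finrank ℂ (LinearMap.ker H) := by
      have hmem : ∀ x ∈ LinearMap.ker (H.domRestrict M), M.subtype x ∈ LinearMap.ker H :=
        fun x hx => hx
      exact LinearMap.finrank_le_finrank_of_injective (f := LinearMap.restrict _ hmem)
        fun x y hxy => by
          have h6 := congrArg Subtype.val hxy
          exact Subtype.ext (Subtype.ext h6)
    omega
  have h4 : finrank ℂ (LinearMap.ker H) ≤
      finrank ℂ (LinearMap.ker N.adjoint) + finrank ℂ (LinearMap.ker N) := by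
    have hmem : ∀ x ∈ LinearMap.ker H, e.toLinearMap x ∈
        (LinearMap.ker N.adjoint).prod (LinearMap.ker N) := by
      intro x hx
      have e1 := congrArg WithLp.fst hx
      have e2 := congrArg WithLp.snd hx
      simp [H] at e1 e2
      exact ⟨e2, e1⟩
    have := LinearMap.finrank_le_finrank_of_injective (f := LinearMap.restrict _ hmem) (by
      intro x y hxy
      exact Subtype.ext (e.injective (congrArg Subtype.val hxy)))
    rwa [finrank_submodule_prod] at this
  have h5 := N.finrank_range_add_finrank_ker
  have h6 := N.adjoint.finrank_range_add_finrank_ker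
  rw [LinearMap.finrank_range_adjoint] at h6
  omega

end ZeroDiagonal

end HigherRank

namespace HigherRank

open Module InnerProductSpace

/-! ### From matrices to isotropic subspaces; compactness -/

section Matrices

variable {ι : Type*} [Fintype ι] [DecidableEq ι]

theorem toEuclideanLin_mul_apply (A B : Matrix ι ι ℂ) (x : EuclideanSpace ℂ ι) :
    Matrix.toEuclideanLin (A * B) x = Matrix.toEuclideanLin A (Matrix.toEuclideanLin B x) := by
  simp [Matrix.toLpLin_apply, Matrix.mulVec_mulVec]

theorem rank_eq_finrank_range_toEuclideanLin {κ : Type*} [Fintype κ] [DecidableEq κ]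
    (A : Matrix κ ι ℂ) :
    A.rank = finrank ℂ (LinearMap.range (Matrix.toEuclideanLin A)) := by
  rw [Matrix.rank_eq_finrank_range_toLin A (EuclideanSpace.basisFun κ ℂ).toBasis
    (EuclideanSpace.basisFun ι ℂ).toBasis, Matrix.toEuclideanLin_eq_toLin_orthonormal]

/-- Orthogonal projections correspond to their ranges L, and PAP = zP says that the compression of A
to L is z. -/
theorem mem_rankNumericalRange_iff {k : ℕ} {A : Matrix ι ι ℂ} {z : ℂ} :
    z ∈ rankNumericalRange k A ↔ ∃ L : Submodule ℂ (EuclideanSpace ℂ ι), finrank ℂ L = k ∧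
      ∀ x ∈ L, ∀ y ∈ L, inner ℂ x (Matrix.toEuclideanLin A y) = z * inner ℂ x y := by
  constructor
  · rintro ⟨P, hP, hrank, hPAP⟩
    have hsa : ∀ x y, inner ℂ (Matrix.toEuclideanLin P x) y =
        inner ℂ x (Matrix.toEuclideanLin P y) := fun x y => by
      have h : Matrix.toEuclideanLin P = (Matrix.toEuclideanLin P).adjoint := by
        rw [← Matrix.toEuclideanLin_conjTranspose_eq_adjoint]
        exact congrArg _ hP.isSelfAdjoint.star_eq.symm
      conv_rhs => rw [h, LinearMap.adjoint_inner_right]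
    refine ⟨LinearMap.range (Matrix.toEuclideanLin P), ?_, ?_⟩
    · rw [← rank_eq_finrank_range_toEuclideanLin, hrank]
    · rintro _ ⟨x, rfl⟩ _ ⟨y, rfl⟩
      rw [hsa, hsa, ← toEuclideanLin_mul_apply, ← toEuclideanLin_mul_apply,
        ← toEuclideanLin_mul_apply, hPAP, hP.isIdempotentElem.eq, map_smul,
        LinearMap.smul_apply, inner_smul_right]
  · rintro ⟨L, hL, hiso⟩
    set P : Matrix ι ι ℂ := Matrix.toEuclideanLin.symm L.starProjection.toLinearMap with hPdef
    have hP : ∀ x, Matrix.toEuclideanLin P x = L.starProjection x := fun x => by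
      rw [hPdef, LinearEquiv.apply_symm_apply]; rfl
    have hPlin : Matrix.toEuclideanLin P = L.starProjection.toLinearMap := by
      rw [hPdef, LinearEquiv.apply_symm_apply]
    have hsymm : ∀ x y, inner ℂ (L.starProjection x) y = inner ℂ x (L.starProjection y) :=
      fun x y => Submodule.inner_starProjection_left_eq_right L x y
    have hidem : ∀ x, L.starProjection (L.starProjection x) = L.starProjection x := fun x =>
      Submodule.starProjection_eq_self_iff.2 (Submodule.starProjection_apply_mem L x)
    refine ⟨P, ⟨?_, ?_⟩, ?_, ?_⟩
    · apply Matrix.toEuclideanLin.injective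
      ext1 x
      rw [toEuclideanLin_mul_apply, hP, hP, hidem]
    · apply Matrix.toEuclideanLin.injective
      rw [Matrix.star_eq_conjTranspose, Matrix.toEuclideanLin_conjTranspose_eq_adjoint]
      ext1 x
      refine ext_inner_left ℂ fun y => ?_
      rw [LinearMap.adjoint_inner_right, hP, hP, hsymm]
    · rw [rank_eq_finrank_range_toEuclideanLin, hPlin]
      have : LinearMap.range L.starProjection.toLinearMap = L := by
        simp
      rw [this, hL]
    · apply Matrix.toEuclideanLin.injective
      ext1 x
      refine ext_inner_left ℂ fun y => ?_
      rw [toEuclideanLin_mul_apply, toEuclideanLin_mul_apply, hP, hP, ← hsymm,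
        hiso _ (Submodule.starProjection_apply_mem L y) _ (Submodule.starProjection_apply_mem L x),
        map_smul, LinearMap.smul_apply, inner_smul_right, hP, hsymm, hidem]

/-- Rank is not continuous but trace is: this makes fixing the rank a closed condition on
projections. -/
theorem rank_eq_iff_trace_eq {P : Matrix ι ι ℂ} (hP : IsIdempotentElem P) (k : ℕ) :
    P.rank = k ↔ P.trace = k := by
  have h1 : IsIdempotentElem (Matrix.toLin' P) := by
    unfold IsIdempotentElem
    rw [Module.End.mul_eq_comp, ← Matrix.toLin'_mul, hP.eq]
  have h2 := (LinearMap.IsIdempotentElem.isProj_range _ h1).trace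
  rw [Matrix.trace_toLin'_eq] at h2
  rw [h2, Nat.cast_inj]
  rfl

theorem isCompact_starProjection_rank (k : ℕ) :
    IsCompact {P : Matrix ι ι ℂ | IsStarProjection P ∧ P.rank = k} := by
  have : ProperSpace (Matrix ι ι ℂ) := FiniteDimensional.proper ℂ _
  refine Metric.isCompact_of_isClosed_isBounded ?_ ?_
  · have hset : {P : Matrix ι ι ℂ | IsStarProjection P ∧ P.rank = k} =
        {P | P * P = P} ∩ {P | star P = P} ∩ {P | P.trace = (k : ℂ)} := by
      ext P
      constructor
      · rintro ⟨hP, hr⟩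
        exact ⟨⟨hP.1, hP.2⟩, (rank_eq_iff_trace_eq hP.1 k).1 hr⟩
      · rintro ⟨⟨h1, h2⟩, h3⟩
        exact ⟨⟨h1, h2⟩, (rank_eq_iff_trace_eq h1 k).2 h3⟩
    rw [hset]
    exact ((isClosed_eq (by fun_prop) (by fun_prop)).inter
      (isClosed_eq (by fun_prop) (by fun_prop))).inter
      (isClosed_eq (continuous_id.matrix_trace) (by fun_prop))
  · refine (Metric.isBounded_closedBall (x := (0 : Matrix ι ι ℂ)) (r := 1)).subset ?_
    rintro P ⟨hP, -⟩
    rw [mem_closedBall_zero_iff]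
    exact hP.norm_le

/-- The graph of the rank-`k` numerical range is closed. -/
theorem isClosed_setOf_mem_rankNumericalRange (k : ℕ) :
    IsClosed {q : Matrix ι ι ℂ × ℂ | q.2 ∈ rankNumericalRange k q.1} := by
  have := isCompact_iff_compactSpace.1 (isCompact_starProjection_rank (ι := ι) k)
  have h : IsClosed {q : (Matrix ι ι ℂ × ℂ) ×
      {P : Matrix ι ι ℂ | IsStarProjection P ∧ P.rank = k} |
        (q.2 : Matrix ι ι ℂ) * q.1.1 * (q.2 : Matrix ι ι ℂ) = q.1.2 • (q.2 : Matrix ι ι ℂ)} :=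
    isClosed_eq (by fun_prop) (by fun_prop)
  -- The graph is the image of a closed set under a projection along the compact space of rank-k
  -- projections.
  convert isClosedMap_fst_of_compactSpace _ h using 1
  ext q
  constructor
  · rintro ⟨P, hP, hr, h⟩
    exact ⟨(q, ⟨P, hP, hr⟩), h, rfl⟩
  · rintro ⟨⟨q, ⟨P, hP, hr⟩⟩, h, rfl⟩
    exact ⟨P, hP, hr, h⟩

theorem mem_rankNumericalRange_of_tendsto {τ : Type*} {l : Filter τ} [l.NeBot] {k : ℕ} {z : ℂ}
    {A : τ → Matrix ι ι ℂ} {A₀ : Matrix ι ι ℂ} (hA : Filter.Tendsto A l (nhds A₀))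
    (h : ∀ᶠ t in l, z ∈ rankNumericalRange k (A t)) : z ∈ rankNumericalRange k A₀ := by
  have hlim : Filter.Tendsto (fun t => (A t, z)) l (nhds (A₀, z)) :=
    hA.prodMk_nhds tendsto_const_nhds
  have hmem : ∀ᶠ t in l, (A t, z) ∈
      {q : Matrix ι ι ℂ × ℂ | q.2 ∈ rankNumericalRange k q.1} := h
  have := (isClosed_setOf_mem_rankNumericalRange k).mem_of_tendsto hlim hmem
  exact this

theorem numericalRange_eq_rankNumericalRange_one (A : Matrix ι ι ℂ) :
    numericalRange A = rankNumericalRange 1 A := by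
  have hin : ∀ x y : EuclideanSpace ℂ ι, inner ℂ x y = star x.ofLp ⬝ᵥ y.ofLp := fun x y => by
    rw [EuclideanSpace.inner_eq_star_dotProduct, dotProduct_comm]
  ext z
  rw [mem_rankNumericalRange_iff]
  constructor
  · rintro ⟨x, hx, rfl⟩
    have hx0 : WithLp.toLp 2 x ≠ 0 := by
      intro h
      have : x = 0 := congrArg WithLp.ofLp h
      simp [this] at hx
    refine ⟨Submodule.span ℂ {WithLp.toLp 2 x}, finrank_span_singleton hx0, ?_⟩
    intro y hy w hw
    obtain ⟨a, rfl⟩ := Submodule.mem_span_singleton.1 hy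
    obtain ⟨b, rfl⟩ := Submodule.mem_span_singleton.1 hw
    rw [map_smul, inner_smul_left, inner_smul_left, inner_smul_right, inner_smul_right, hin, hin,
      hx, Matrix.toLpLin_apply]
    ring
  · rintro ⟨L, hL, hiso⟩
    obtain ⟨x, hx, hx0⟩ := Submodule.exists_mem_ne_zero_of_ne_bot
      (p := L) (fun h => by rw [h, finrank_bot] at hL; omega)
    have hn : (‖x‖ : ℂ) ≠ 0 := by simpa using hx0
    set y : EuclideanSpace ℂ ι := (‖x‖ : ℂ)⁻¹ • x with hy
    have hyL : y ∈ L := L.smul_mem _ hx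
    have hyy : inner ℂ y y = 1 := by
      rw [inner_self_eq_norm_sq_to_K, hy, norm_smul, norm_inv, Complex.norm_real, norm_norm,
        inv_mul_cancel₀ (by simpa using hx0)]
      simp
    refine ⟨y.ofLp, by rw [← hin, hyy], ?_⟩
    have := hiso y hyL y hyL
    rw [hyy, mul_one, hin, Matrix.toLpLin_apply] at this
    exact this.symm

theorem norm_eq_singularValue_one {r m : ℕ} (hm : 0 < m) (N : Matrix (Fin r) (Fin m) ℂ) :
    ‖N‖ = singularValue N 1 := by
  apply le_antisymm
  · obtain ⟨S, hS, hle⟩ := exists_lt_finrank_forall_le_singularValues_mul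
      (Matrix.toEuclideanLin N) le_rfl
    have htop : S = ⊤ := Submodule.eq_top_of_finrank_eq
      (le_antisymm (Submodule.finrank_le S) (by omega))
    rw [Matrix.l2_opNorm_def]
    refine ContinuousLinearMap.opNorm_le_bound _ (LinearMap.singularValues_nonneg _ _) fun v => ?_
    exact hle v (htop ▸ Submodule.mem_top)
  · obtain ⟨X, hX, hle⟩ := exists_finrank_eq_forall_singularValues_mul_le
      (Matrix.toEuclideanLin N) (k := 1) (by rw [finrank_euclideanSpace_fin]; omega)
    obtain ⟨x, hx, hx0⟩ := Submodule.exists_mem_ne_zero_of_ne_bot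
      (p := X) (fun h => by rw [h, finrank_bot] at hX; omega)
    have h1 := hle x hx
    have h2 := N.l2_opNorm_mulVec x
    exact le_of_mul_le_mul_right (h1.trans h2) (norm_pos_iff.2 hx0)

theorem mem_rankNumericalRange_blockMatrix_iff {r m k : ℕ} {α β z : ℂ}
    {C : Matrix (Fin r) (Fin m) ℂ} {D : Matrix (Fin m) (Fin r) ℂ} :
    z ∈ rankNumericalRange k (blockMatrix α β C D) ↔
      HasIsotropic k (α - z) (β - z) (Matrix.toEuclideanLin C) (Matrix.toEuclideanLin D) := by
  rw [mem_rankNumericalRange_iff]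
  let e : EuclideanSpace ℂ (Fin r ⊕ Fin m) ≃ₗ[ℂ]
      EuclideanSpace ℂ (Fin r) × EuclideanSpace ℂ (Fin m) :=
    (WithLp.linearEquiv 2 ℂ _).trans ((LinearEquiv.sumArrowLequivProdArrow _ _ ℂ ℂ).trans
      (LinearEquiv.prodCongr (WithLp.linearEquiv 2 ℂ _).symm (WithLp.linearEquiv 2 ℂ _).symm))
  have he : ∀ x y : EuclideanSpace ℂ (Fin r ⊕ Fin m),
      inner ℂ x (Matrix.toEuclideanLin (blockMatrix α β C D) y) - z * inner ℂ x y =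
        blockForm (α - z) (β - z) (Matrix.toEuclideanLin C) (Matrix.toEuclideanLin D)
          (e x) (e y) := by
    intro x y
    have hin : ∀ x y : EuclideanSpace ℂ (Fin r ⊕ Fin m), inner ℂ x y =
        inner ℂ (e x).1 (e y).1 + inner ℂ (e x).2 (e y).2 := by
      intro x y
      rw [PiLp.inner_apply, PiLp.inner_apply, PiLp.inner_apply, Fintype.sum_sum_type]
      rfl
    have h1 : (e (Matrix.toEuclideanLin (blockMatrix α β C D) y)).1 =
        α • (e y).1 + Matrix.toEuclideanLin C (e y).2 := by
      ext i
      change (blockMatrix α β C D *ᵥ y.ofLp) (Sum.inl i) =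
        α * y.ofLp (Sum.inl i) + (C *ᵥ fun j => y.ofLp (Sum.inr j)) i
      rw [blockMatrix, Matrix.fromBlocks_mulVec]
      simp [Matrix.smul_mulVec, Function.comp_def]
    have h2 : (e (Matrix.toEuclideanLin (blockMatrix α β C D) y)).2 =
        β • (e y).2 + Matrix.toEuclideanLin D (e y).1 := by
      ext i
      change (blockMatrix α β C D *ᵥ y.ofLp) (Sum.inr i) =
        β * y.ofLp (Sum.inr i) + (D *ᵥ fun j => y.ofLp (Sum.inl j)) i
      rw [blockMatrix, Matrix.fromBlocks_mulVec]
      simp [Matrix.smul_mulVec, Function.comp_def, add_comm]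
    rw [hin, hin, h1, h2]
    simp only [blockForm, inner_add_right, inner_smul_right]
    ring
  constructor
  · rintro ⟨L, hL, hiso⟩
    refine ⟨L.map e.toLinearMap, by rw [← hL]; exact LinearEquiv.finrank_map_eq _ _, ?_⟩
    rintro _ ⟨x, hx, rfl⟩ _ ⟨y, hy, rfl⟩
    exact (he x y).symm.trans (sub_eq_zero.2 (hiso x hx y hy))
  · rintro ⟨L, hL, hiso⟩
    refine ⟨L.map e.symm.toLinearMap, by rw [← hL]; exact LinearEquiv.finrank_map_eq _ _, ?_⟩
    rintro _ ⟨x, hx, rfl⟩ _ ⟨y, hy, rfl⟩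
    refine sub_eq_zero.1 ((he _ _).trans ?_)
    simpa using hiso x hx y hy

end Matrices

end HigherRank

namespace HigherRank

open Module InnerProductSpace Filter Topology

/-! ### Elliptical discs through the discrepancy -/

section Ellipse

theorem mem_ellipticalDisc_iff {α β z : ℂ} {s : ℝ} :
    z ∈ ellipticalDisc α β s ↔ discrepancy (α - z) (β - z) ≤ s ^ 2 := by
  rw [discrepancy_eq, sub_sub_sub_cancel_right, norm_sub_rev α z, norm_sub_rev β z, ellipticalDisc,
    Set.mem_ofPred_eq, Real.le_sqrt (by positivity) (by positivity), sub_le_iff_le_add']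

theorem ellipticalDisc_comm (α β : ℂ) (s : ℝ) : ellipticalDisc α β s = ellipticalDisc β α s := by
  ext z
  rw [mem_ellipticalDisc_iff, mem_ellipticalDisc_iff, discrepancy_comm]

theorem ellipticalDisc_zero (α β : ℂ) : ellipticalDisc α β 0 = segment ℝ α β := by
  ext z
  rw [mem_segment_iff_wbtw, ← dist_add_dist_eq_iff, ellipticalDisc, Set.mem_ofPred_eq,
    zero_pow two_ne_zero, add_zero, Real.sqrt_sq (norm_nonneg _), dist_comm α z, dist_eq_norm,
    dist_eq_norm, dist_eq_norm]
  refine ⟨fun h => le_antisymm h ?_, fun h => h.le⟩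
  calc ‖α - β‖ = ‖(z - β) - (z - α)‖ := by congr 1; ring
    _ ≤ ‖z - β‖ + ‖z - α‖ := norm_sub_le _ _
    _ = _ := add_comm _ _

/-- Points moved towards the centre of an elliptical disc lie in its interior. -/
theorem discrepancy_lt_of_mem_ellipticalDisc {α β z : ℂ} {s t : ℝ} (hs : 0 < s)
    (hz : z ∈ ellipticalDisc α β s) (ht0 : 0 ≤ t) (ht1 : t < 1) :
    discrepancy (α - ((1 - t : ℝ) * ((α + β) / 2) + t * z))
      (β - ((1 - t : ℝ) * ((α + β) / 2) + t * z)) < s ^ 2 := by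
  set w : ℂ := (1 - t : ℝ) * ((α + β) / 2) + t * z with hw
  set R := √(‖α - β‖ ^ 2 + s ^ 2) with hR
  have hz' : ‖z - α‖ + ‖z - β‖ ≤ R := hz
  have hRsq : R ^ 2 = ‖α - β‖ ^ 2 + s ^ 2 := Real.sq_sqrt (by positivity)
  have hlt : ‖α - β‖ < R := by
    refine lt_of_pow_lt_pow_left₀ 2 (Real.sqrt_nonneg _) ?_
    rw [hRsq]
    have : 0 < s ^ 2 := by positivity
    linarith
  have ht : ‖(t : ℂ)‖ = t := by rw [Complex.norm_real, Real.norm_of_nonneg ht0]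
  have ht' : ‖((1 - t : ℝ) : ℂ)‖ = 1 - t := by
    rw [Complex.norm_real, Real.norm_of_nonneg (by linarith)]
  have h1 : ‖α - w‖ ≤ (1 - t) * (‖α - β‖ / 2) + t * ‖z - α‖ := by
    have : α - w = (1 - t : ℝ) * ((α - β) / 2) - t * (z - α) := by
      rw [hw]; push_cast; ring
    rw [this]
    refine (norm_sub_le _ _).trans (le_of_eq ?_)
    rw [norm_mul, norm_mul, ht, ht', norm_div, Complex.norm_ofNat]
  have h2 : ‖β - w‖ ≤ (1 - t) * (‖α - β‖ / 2) + t * ‖z - β‖ := by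
    have : β - w = -((1 - t : ℝ) * ((α - β) / 2)) - t * (z - β) := by
      rw [hw]; push_cast; ring
    rw [this]
    refine (norm_sub_le _ _).trans (le_of_eq ?_)
    rw [norm_neg, norm_mul, norm_mul, ht, ht', norm_div, Complex.norm_ofNat]
  have h3 : ‖α - w‖ + ‖β - w‖ < R := by nlinarith
  rw [discrepancy_eq, sub_sub_sub_cancel_right]
  have := pow_lt_pow_left₀ h3 (by positivity) two_ne_zero
  linarith

end Ellipse

/-! ### Restriction to subspaces and perturbation -/

section LowerBounds

variable {U V : Type*} [NormedAddCommGroup U] [InnerProductSpace ℂ U]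
  [NormedAddCommGroup V] [InnerProductSpace ℂ V]

/-- Any linear map becomes injective on a `k`-dimensional subspace after subtracting small multiples
of a fixed map, provided both dimensions are at least `k`. -/
theorem exists_eventually_injOn_sub_smul (N : V →ₗ[ℂ] U) {k : ℕ} (hU : k ≤ finrank ℂ U)
    (hV : k ≤ finrank ℂ V) :
    ∃ (X : Submodule ℂ V) (M : V →ₗ[ℂ] U), finrank ℂ X = k ∧
      ∀ᶠ t : ℂ in 𝓝[≠] 0, ∀ v ∈ X, (N - t • M) v = 0 → v = 0 := by
  obtain ⟨f, hf⟩ := exists_linearIndependent_of_le_finrank (R := ℂ) (M := V) hV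
  obtain ⟨g, hg⟩ := exists_linearIndependent_of_le_finrank (R := ℂ) (M := U) hU
  have hf' := linearIndependent_iff_injective_fintypeLinearCombination.1 hf
  have hg' := linearIndependent_iff_injective_fintypeLinearCombination.1 hg
  set J := Fintype.linearCombination ℂ f
  set K := Fintype.linearCombination ℂ g
  obtain ⟨J', hJ'⟩ := LinearMap.exists_leftInverse_of_injective J (LinearMap.ker_eq_bot.2 hf')
  obtain ⟨K', hK'⟩ := LinearMap.exists_leftInverse_of_injective K (LinearMap.ker_eq_bot.2 hg')
  refine ⟨LinearMap.range J, K ∘ₗ J', ?_, ?_⟩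
  · rw [LinearMap.finrank_range_of_inj hf', finrank_fin_fun]
  -- Compressing N - tM by J and K' gives K'NJ - t, singular only at the finitely many eigenvalues
  -- of K'NJ. A punctured neighbourhood of 0 avoids them.
  · have hfin := End.finite_hasEigenvalue (K' ∘ₗ N ∘ₗ J)
    have hmem : ({t | End.HasEigenvalue (K' ∘ₗ N ∘ₗ J) t} \ {0})ᶜ ∈ 𝓝 (0 : ℂ) :=
      (hfin.subset Set.sdiff_subset).isClosed.isOpen_compl.mem_nhds (by simp)
    filter_upwards [mem_nhdsWithin_of_mem_nhds hmem, self_mem_nhdsWithin] with t ht ht0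
    rintro _ ⟨w, rfl⟩ hw
    have hw' := congrArg K' hw
    have e1 : J' (J w) = w := LinearMap.congr_fun hJ' w
    have e2 : K' (K w) = w := LinearMap.congr_fun hK' w
    simp only [LinearMap.sub_apply, LinearMap.smul_apply, LinearMap.comp_apply, map_sub, map_smul,
      map_zero, e1, e2] at hw'
    have hw0 : w = 0 := by
      by_contra hne
      refine ht ⟨End.hasEigenvalue_of_hasEigenvector (x := w) ⟨?_, hne⟩, ht0⟩
      rw [End.mem_eigenspace_iff]
      exact sub_eq_zero.1 hw'
    rw [hw0, map_zero]

variable [FiniteDimensional ℂ U] [FiniteDimensional ℂ V]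

/-- Apply the previous construction to N restricted to X; the inclusion U × X → U × V preserves the
block form. -/
theorem hasIsotropic_of_discrepancy_lt_on {E : U →ₗ[ℂ] U} (hE : E.IsSymmetric)
    (hEE : ∀ u, E (E u) = E u) (N : V →ₗ[ℂ] U) {a b : ℂ} (ha : a ≠ 0) (X : Submodule ℂ V)
    (hlt : ∀ v ∈ X, v ≠ 0 → discrepancy a b * ‖v‖ ^ 2 < ‖N v‖ ^ 2) :
    HasIsotropic (finrank ℂ X) a b ((LinearMap.id - E) ∘ₗ N) (N.adjoint ∘ₗ E) := by
  obtain ⟨L, hL, hiso⟩ := hasIsotropic_of_discrepancy_lt hE hEE (N ∘ₗ X.subtype) (b := b) ha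
    (fun v hv => hlt v v.2 fun h => hv (Subtype.ext h))
  have hinj : Function.Injective ((LinearMap.id (R := ℂ) (M := U)).prodMap X.subtype) :=
    Function.Injective.prodMap Function.injective_id X.injective_subtype
  refine ⟨L.map (LinearMap.id.prodMap X.subtype), ?_, ?_⟩
  · rw [← hL]; exact (Submodule.equivMapOfInjective _ hinj L).finrank_eq.symm
  · rintro _ ⟨x, hx, rfl⟩ _ ⟨y, hy, rfl⟩
    have h := hiso x hx y hy
    simp only [blockForm, LinearMap.comp_apply, LinearMap.adjoint_inner_right] at h
    simp only [blockForm, LinearMap.comp_apply, LinearMap.adjoint_inner_right]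
    exact h

/-- The form vanishes on U × ker N, of dimension dim U + dim V - rank N. -/
theorem hasIsotropic_zero_zero (E : U →ₗ[ℂ] U) (N : V →ₗ[ℂ] U) {k : ℕ}
    (hk : k + finrank ℂ (LinearMap.range N) ≤ finrank ℂ U + finrank ℂ V) :
    HasIsotropic k 0 0 ((LinearMap.id - E) ∘ₗ N) (N.adjoint ∘ₗ E) := by
  refine HasIsotropic.of_le_finrank (L := (⊤ : Submodule ℂ U).prod (LinearMap.ker N)) ?_ ?_
  · have := N.finrank_range_add_finrank_ker
    rw [finrank_submodule_prod, finrank_top]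
    omega
  · rintro x ⟨-, hx⟩ y ⟨-, hy⟩
    have hx : N x.2 = 0 := hx
    have hy : N y.2 = 0 := hy
    simp [blockForm, hy, LinearMap.adjoint_inner_right, hx]

end LowerBounds

/-! ### Inclusions for C = (1 - F)N, D = N*F -/

section BlockMatrix

variable {r m : ℕ}

theorem rankNumericalRange_blockMatrix_swap (k : ℕ) (α β : ℂ) (C : Matrix (Fin r) (Fin m) ℂ)
    (D : Matrix (Fin m) (Fin r) ℂ) :
    rankNumericalRange k (blockMatrix α β C D) = rankNumericalRange k (blockMatrix β α D C) := by
  ext z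
  rw [mem_rankNumericalRange_blockMatrix_iff, mem_rankNumericalRange_blockMatrix_iff]
  exact ⟨HasIsotropic.swap, HasIsotropic.swap⟩

theorem ColumnPattern.swap {C : Matrix (Fin r) (Fin m) ℂ} {D : Matrix (Fin m) (Fin r) ℂ}
    (h : ColumnPattern C D) : RowPattern D C := by
  obtain ⟨ν, h1, h2⟩ := h
  exact ⟨νᶜ, h2, fun j hj => h1 j (not_not.1 hj)⟩

/-- F is the coordinate projection onto ν: D* fills the rows in ν of N, and C the others. -/
theorem RowPattern.exists_projection {C : Matrix (Fin r) (Fin m) ℂ} {D : Matrix (Fin m) (Fin r) ℂ}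
    (h : RowPattern C D) : ∃ F : Matrix (Fin r) (Fin r) ℂ, IsStarProjection F ∧
      C = (1 - F) * (C + Dᴴ) ∧ D = (C + Dᴴ)ᴴ * F := by
  classical
  obtain ⟨ν, h1, h2⟩ := h
  refine ⟨Matrix.diagonal fun i => if i ∈ ν then 1 else 0, ⟨?_, ?_⟩, ?_, ?_⟩
  · simp [IsIdempotentElem]
  · rw [isSelfAdjoint_iff, Matrix.star_eq_conjTranspose, Matrix.diagonal_conjTranspose]
    congr 1
    ext i
    by_cases hi : i ∈ ν <;> simp [hi]
  · ext i j
    rw [Matrix.sub_mul, Matrix.one_mul, Matrix.sub_apply, Matrix.diagonal_mul]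
    by_cases hi : i ∈ ν
    · simp [hi, h1 i hi]
    · simp [hi, h2 i hi]
  · ext j i
    rw [Matrix.mul_diagonal]
    by_cases hi : i ∈ ν
    · simp [hi, h1 i hi]
    · simp [hi, h2 i hi]

theorem toEuclideanLin_mul {l n p : ℕ} (A : Matrix (Fin l) (Fin n) ℂ)
    (B : Matrix (Fin n) (Fin p) ℂ) :
    Matrix.toEuclideanLin (A * B) = Matrix.toEuclideanLin A ∘ₗ Matrix.toEuclideanLin B := by
  ext1 x
  simp [Matrix.toLpLin_apply, Matrix.mulVec_mulVec]

theorem toEuclideanLin_one_sub (F : Matrix (Fin r) (Fin r) ℂ) :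
    Matrix.toEuclideanLin (1 - F) = LinearMap.id - Matrix.toEuclideanLin F := by
  rw [map_sub]
  congr 1
  ext1 x
  simp

theorem toEuclideanLin_conjTranspose {l n : ℕ} (A : Matrix (Fin l) (Fin n) ℂ) :
    Matrix.toEuclideanLin Aᴴ = (Matrix.toEuclideanLin A).adjoint :=
  Matrix.toEuclideanLin_conjTranspose_eq_adjoint A

theorem isSymmetric_toEuclideanLin {F : Matrix (Fin r) (Fin r) ℂ} (hF : IsStarProjection F) :
    (Matrix.toEuclideanLin F).IsSymmetric := by
  rw [LinearMap.isSymmetric_iff_isSelfAdjoint, LinearMap.isSelfAdjoint_iff',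
    ← toEuclideanLin_conjTranspose]
  exact congrArg _ hF.isSelfAdjoint.star_eq

theorem toEuclideanLin_idem {F : Matrix (Fin r) (Fin r) ℂ} (hF : IsStarProjection F) (u) :
    Matrix.toEuclideanLin F (Matrix.toEuclideanLin F u) = Matrix.toEuclideanLin F u := by
  rw [← LinearMap.comp_apply, ← toEuclideanLin_mul, hF.isIdempotentElem.eq]

variable {F : Matrix (Fin r) (Fin r) ℂ}

theorem mem_rankNumericalRange_of_discrepancy_lt (hF : IsStarProjection F)
    (N : Matrix (Fin r) (Fin m) ℂ) {α β z : ℂ} (X : Submodule ℂ (EuclideanSpace ℂ (Fin m)))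
    (hr : finrank ℂ X ≤ r)
    (hlt : ∀ v ∈ X, v ≠ 0 →
      discrepancy (α - z) (β - z) * ‖v‖ ^ 2 < ‖Matrix.toEuclideanLin N v‖ ^ 2) :
    z ∈ rankNumericalRange (finrank ℂ X) (blockMatrix α β ((1 - F) * N) (Nᴴ * F)) := by
  rw [mem_rankNumericalRange_blockMatrix_iff]
  -- The pencil argument needs a ≠ 0; at z = α the summand U is itself isotropic and large enough.
  by_cases ha : α - z = 0
  · rw [ha]
    exact HasIsotropic.of_left_eq_zero (by rwa [finrank_euclideanSpace_fin])
  · rw [toEuclideanLin_mul, toEuclideanLin_mul, toEuclideanLin_one_sub,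
      toEuclideanLin_conjTranspose]
    exact hasIsotropic_of_discrepancy_lt_on (isSymmetric_toEuclideanLin hF)
      (toEuclideanLin_idem hF) _ ha X hlt

/-- Moving z towards the centre makes the inequality strict; closedness of Λ_k recovers z in the
limit. -/
theorem ellipticalDisc_subset_of_projection (hF : IsStarProjection F)
    (N : Matrix (Fin r) (Fin m) ℂ) {α β : ℂ} {s : ℝ} (hs : 0 < s)
    (X : Submodule ℂ (EuclideanSpace ℂ (Fin m))) (hr : finrank ℂ X ≤ r)
    (hX : ∀ v ∈ X, s * ‖v‖ ≤ ‖Matrix.toEuclideanLin N v‖) :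
    ellipticalDisc α β s ⊆
      rankNumericalRange (finrank ℂ X) (blockMatrix α β ((1 - F) * N) (Nᴴ * F)) := by
  intro z hz
  set A := blockMatrix α β ((1 - F) * N) (Nᴴ * F)
  have hclosed : IsClosed (rankNumericalRange (finrank ℂ X) A) :=
    (isClosed_setOf_mem_rankNumericalRange (finrank ℂ X)).preimage
      (f := fun w : ℂ => (A, w)) (by fun_prop)
  have hlim : Tendsto (fun t : ℝ => ((1 - t : ℝ) : ℂ) * ((α + β) / 2) + t * z) (𝓝[<] 1) (𝓝 z) := by
    have h : Continuous fun t : ℝ => ((1 - t : ℝ) : ℂ) * ((α + β) / 2) + t * z := by fun_prop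
    have h1 := h.tendsto 1
    simp only [sub_self, Complex.ofReal_zero, zero_mul, Complex.ofReal_one, one_mul,
      zero_add] at h1
    exact h1.mono_left nhdsWithin_le_nhds
  refine hclosed.mem_of_tendsto hlim ?_
  filter_upwards [Ioo_mem_nhdsLT (zero_lt_one' ℝ)] with t ht
  refine mem_rankNumericalRange_of_discrepancy_lt hF N X hr fun v hv hv0 => ?_
  have h1 := discrepancy_lt_of_mem_ellipticalDisc hs hz ht.1.le ht.2
  have h2 : 0 < ‖v‖ ^ 2 := by positivity
  have h3 := pow_le_pow_left₀ (by positivity) (hX v hv) 2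
  rw [mul_pow] at h3
  exact (mul_lt_mul_of_pos_right h1 h2).trans_le h3

theorem continuous_blockMatrix_sub_smul (F : Matrix (Fin r) (Fin r) ℂ)
    (N M : Matrix (Fin r) (Fin m) ℂ) (α β : ℂ) :
    Continuous fun t : ℂ => blockMatrix α β ((1 - F) * (N - t • M)) ((N - t • M)ᴴ * F) := by
  have h : Continuous fun t : ℂ => N - t • M := by fun_prop
  exact Continuous.matrix_fromBlocks continuous_const (continuous_const.matrix_mul h)
    (h.matrix_conjTranspose.matrix_mul continuous_const) continuous_const

/-- On the segment the discrepancy is at most 0, so injectivity on a k-dimensional subspace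
suffices. A small perturbation of N achieves it, and closedness of the graph allows the limit. -/
theorem segment_subset_of_projection (hF : IsStarProjection F) (N : Matrix (Fin r) (Fin m) ℂ)
    {α β : ℂ} {k : ℕ} (hr : k ≤ r) (hm : k ≤ m) :
    segment ℝ α β ⊆ rankNumericalRange k (blockMatrix α β ((1 - F) * N) (Nᴴ * F)) := by
  intro z hz
  rw [← ellipticalDisc_zero, mem_ellipticalDisc_iff] at hz
  obtain ⟨X, M, hX, hinj⟩ := exists_eventually_injOn_sub_smul (Matrix.toEuclideanLin N) (k := k)
    (by rwa [finrank_euclideanSpace_fin]) (by rwa [finrank_euclideanSpace_fin])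
  obtain ⟨M', rfl⟩ := Matrix.toEuclideanLin.surjective M
  have hlim := (continuous_blockMatrix_sub_smul F N M' α β).tendsto 0
  rw [zero_smul, sub_zero] at hlim
  refine mem_rankNumericalRange_of_tendsto
    (hlim.mono_left (nhdsWithin_le_nhds (s := {0}ᶜ))) ?_
  filter_upwards [hinj] with t ht
  rw [← hX]
  refine mem_rankNumericalRange_of_discrepancy_lt hF _ X (by rwa [hX]) fun v hv hv0 => ?_
  have h1 : 0 < ‖Matrix.toEuclideanLin (N - t • M') v‖ := by
    rw [norm_pos_iff, map_sub, map_smul]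
    exact fun h => hv0 (ht v hv h)
  have h2 := mul_le_mul_of_nonneg_right hz (sq_nonneg ‖v‖)
  have h3 : 0 < ‖Matrix.toEuclideanLin (N - t • M') v‖ ^ 2 := by positivity
  linarith

end BlockMatrix

end HigherRank

namespace HigherRank

open Module InnerProductSpace

/-! ### The two zero patterns -/

section Patterns

variable {r m : ℕ} {C : Matrix (Fin r) (Fin m) ℂ} {D : Matrix (Fin m) (Fin r) ℂ}

theorem conjTranspose_add_conjTranspose (C : Matrix (Fin r) (Fin m) ℂ)
    (D : Matrix (Fin m) (Fin r) ℂ) : D + Cᴴ = (C + Dᴴ)ᴴ := by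
  rw [Matrix.conjTranspose_add, Matrix.conjTranspose_conjTranspose, add_comm]

/-- Here cC + c̄D* is a unitary twist applied after N, so the extremal subspace of N works for every
c. -/
theorem RowPattern.exists_norm_le (h : RowPattern C D) {k : ℕ} (hk : 1 ≤ k) (c : ℂ)
    (hc : ‖c‖ = 1) :
    ∃ S : Submodule ℂ (EuclideanSpace ℂ (Fin m)),
      finrank ℂ (EuclideanSpace ℂ (Fin m)) < finrank ℂ S + k ∧
      ∀ v ∈ S, ‖c • Matrix.toEuclideanLin C v + star c • (Matrix.toEuclideanLin D).adjoint v‖ ≤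
        singularValue (C + Dᴴ) k * ‖v‖ := by
  obtain ⟨F, hF, hC, hD⟩ := h.exists_projection
  set N := C + Dᴴ
  obtain ⟨S, hS, hle⟩ := exists_lt_finrank_forall_le_singularValues_mul
    (Matrix.toEuclideanLin N) hk
  refine ⟨S, hS, fun v hv => ?_⟩
  have hDH : Dᴴ = F * N := by
    rw [hD, Matrix.conjTranspose_mul, Matrix.conjTranspose_conjTranspose]
    exact congrArg (· * N) hF.isSelfAdjoint.star_eq
  have heq : c • Matrix.toEuclideanLin C v + star c • (Matrix.toEuclideanLin D).adjoint v =
      twist (Matrix.toEuclideanLin F) c (Matrix.toEuclideanLin N v) := by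
    rw [← toEuclideanLin_conjTranspose, hDH, hC, toEuclideanLin_mul, toEuclideanLin_mul,
      toEuclideanLin_one_sub]
    rfl
  rw [heq, norm_twist (isSymmetric_toEuclideanLin hF) (toEuclideanLin_idem hF), hc, one_mul]
  exact hle v hv

theorem ColumnPattern.exists_norm_le (h : ColumnPattern C D) {k : ℕ} (hk : 1 ≤ k) (c : ℂ)
    (hc : ‖c‖ = 1) :
    ∃ S : Submodule ℂ (EuclideanSpace ℂ (Fin m)),
      finrank ℂ (EuclideanSpace ℂ (Fin m)) < finrank ℂ S + k ∧
      ∀ v ∈ S, ‖c • Matrix.toEuclideanLin C v + star c • (Matrix.toEuclideanLin D).adjoint v‖ ≤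
        singularValue (C + Dᴴ) k * ‖v‖ := by
  obtain ⟨F, hF, hD, hC⟩ := h.swap.exists_projection
  rw [conjTranspose_add_conjTranspose, Matrix.conjTranspose_conjTranspose] at hC
  rw [conjTranspose_add_conjTranspose] at hD
  set N := C + Dᴴ
  obtain ⟨S, hS, hle⟩ := exists_lt_finrank_forall_le_singularValues_mul
    (Matrix.toEuclideanLin N) hk
  have hsymm := isSymmetric_toEuclideanLin hF
  have hidem := toEuclideanLin_idem hF
  have hnorm : ∀ w, ‖twist (Matrix.toEuclideanLin F) c w‖ = ‖w‖ := fun w => by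
    rw [norm_twist hsymm hidem, hc, one_mul]
  have hinj : Function.Injective (twist (Matrix.toEuclideanLin F) c) := by
    rw [← LinearMap.ker_eq_bot, LinearMap.ker_eq_bot']
    intro w hw
    rw [← norm_eq_zero, ← hnorm, hw, norm_zero]
  -- Now cC + c̄D* is N applied after the twist by c̄, whose inverse is the twist by c; the subspace
  -- therefore depends on c.
  refine ⟨S.map (twist (Matrix.toEuclideanLin F) c), ?_, ?_⟩
  · rwa [← (Submodule.equivMapOfInjective _ hinj S).finrank_eq]
  · rintro _ ⟨w, hw, rfl⟩
    have hDH : Dᴴ = N * (1 - F) := by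
      rw [hD, Matrix.conjTranspose_mul, Matrix.conjTranspose_conjTranspose,
        Matrix.conjTranspose_sub, Matrix.conjTranspose_one]
      exact congrArg (fun G => N * (1 - G)) hF.isSelfAdjoint.star_eq
    have heq : ∀ v, c • Matrix.toEuclideanLin C v + star c • (Matrix.toEuclideanLin D).adjoint v =
        Matrix.toEuclideanLin N (twist (Matrix.toEuclideanLin F) (star c) v) := by
      intro v
      rw [← toEuclideanLin_conjTranspose, hDH, hC, toEuclideanLin_mul, toEuclideanLin_mul,
        toEuclideanLin_one_sub]
      simp only [twist, LinearMap.add_apply, LinearMap.smul_apply, LinearMap.sub_apply,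
        LinearMap.id_apply, LinearMap.comp_apply, map_add, map_smul, star_star]
      exact add_comm _ _
    have hcc : star c * c = 1 := by
      rw [mul_comm]
      refine (Complex.mul_conj' c).trans ?_
      rw [hc]; simp
    rw [heq, twist_twist hidem, hcc, one_smul, hnorm]
    exact hle w hw

theorem rankNumericalRange_subset_ellipticalDisc (h : RowPattern C D ∨ ColumnPattern C D)
    (α β : ℂ) {k : ℕ} (hk : 1 ≤ k) :
    rankNumericalRange k (blockMatrix α β C D) ⊆
      ellipticalDisc α β (singularValue (C + Dᴴ) k) := by
  intro z hz
  rw [mem_rankNumericalRange_blockMatrix_iff] at hz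
  rw [mem_ellipticalDisc_iff]
  refine hz.discrepancy_le fun c hc => ?_
  exact h.elim (fun h => h.exists_norm_le hk c hc) (fun h => h.exists_norm_le hk c hc)

theorem RowPattern.ellipticalDisc_subset (h : RowPattern C D) (α β : ℂ) {s : ℝ} (hs : 0 < s)
    (X : Submodule ℂ (EuclideanSpace ℂ (Fin m))) (hr : finrank ℂ X ≤ r)
    (hX : ∀ v ∈ X, s * ‖v‖ ≤ ‖Matrix.toEuclideanLin (C + Dᴴ) v‖) :
    ellipticalDisc α β s ⊆ rankNumericalRange (finrank ℂ X) (blockMatrix α β C D) := by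
  obtain ⟨F, hF, hC, hD⟩ := h.exists_projection
  have := ellipticalDisc_subset_of_projection hF (C + Dᴴ) (α := α) (β := β) hs X hr hX
  rwa [← hC, ← hD] at this

theorem ellipticalDisc_subset_rankNumericalRange (h : RowPattern C D ∨ ColumnPattern C D)
    (α β : ℂ) {k : ℕ} (hk : 1 ≤ k) (hkp : k ≤ (C + Dᴴ).rank) :
    ellipticalDisc α β (singularValue (C + Dᴴ) k) ⊆
      rankNumericalRange k (blockMatrix α β C D) := by
  have hr : k ≤ r := hkp.trans (by simpa using (C + Dᴴ).rank_le_card_height)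
  have hm : k ≤ m := hkp.trans (by simpa using (C + Dᴴ).rank_le_card_width)
  have hs : 0 < singularValue (C + Dᴴ) k := by
    rw [singularValue, LinearMap.singularValues_pos_iff_lt_finrank_range,
      ← rank_eq_finrank_range_toEuclideanLin]
    omega
  obtain ⟨X, hXk, hX⟩ := exists_finrank_eq_forall_singularValues_mul_le
    (Matrix.toEuclideanLin (C + Dᴴ)) (k := k) (by rwa [finrank_euclideanSpace_fin])
  rcases h with h | h
  · have := h.ellipticalDisc_subset α β hs X (by omega) hX
    rwa [hXk] at this
  -- Exchanging the summands replaces N by N*, so the test subspace X is replaced by its image NX.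
  · obtain ⟨hX'k, hX'⟩ := exists_finrank_eq_forall_mul_le_adjoint hs hX
    rw [hXk] at hX'k
    have hadj : Matrix.toEuclideanLin (D + Cᴴ) = (Matrix.toEuclideanLin (C + Dᴴ)).adjoint :=
      (congrArg _ (conjTranspose_add_conjTranspose C D)).trans (toEuclideanLin_conjTranspose _)
    have := h.swap.ellipticalDisc_subset β α hs (X.map (Matrix.toEuclideanLin (C + Dᴴ)))
      (by omega) (by rw [hadj]; exact hX')
    rwa [hX'k, ellipticalDisc_comm, ← rankNumericalRange_blockMatrix_swap] at this

theorem segment_subset_rankNumericalRange (h : RowPattern C D ∨ ColumnPattern C D)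
    (α β : ℂ) {k : ℕ} (hr : k ≤ r) (hm : k ≤ m) :
    segment ℝ α β ⊆ rankNumericalRange k (blockMatrix α β C D) := by
  rcases h with h | h
  · obtain ⟨F, hF, hC, hD⟩ := h.exists_projection
    have := segment_subset_of_projection hF (C + Dᴴ) (α := α) (β := β) hr hm
    rwa [← hC, ← hD] at this
  · obtain ⟨F, hF, hD, hC⟩ := h.swap.exists_projection
    have := segment_subset_of_projection hF (D + Cᴴ) (α := β) (β := α) hm hr
    rwa [← hC, ← hD, segment_symm, ← rankNumericalRange_blockMatrix_swap] at this

theorem singularValue_eq_zero {N : Matrix (Fin r) (Fin m) ℂ} {k : ℕ} (hk : N.rank < k) :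
    singularValue N k = 0 := by
  rw [singularValue, LinearMap.singularValues_eq_zero_iff_le_finrank_range,
    ← rank_eq_finrank_range_toEuclideanLin]
  omega

theorem rankNumericalRange_eq_ellipticalDisc (h : RowPattern C D ∨ ColumnPattern C D)
    (α β : ℂ) {k : ℕ} (hk : 1 ≤ k) (hr : k ≤ r) (hm : k ≤ m) :
    rankNumericalRange k (blockMatrix α β C D) =
      ellipticalDisc α β (singularValue (C + Dᴴ) k) := by
  refine (rankNumericalRange_subset_ellipticalDisc h α β hk).antisymm ?_
  rcases le_or_gt k (C + Dᴴ).rank with hkp | hkp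
  · exact ellipticalDisc_subset_rankNumericalRange h α β hk hkp
  · rw [singularValue_eq_zero hkp, ellipticalDisc_zero]
    exact segment_subset_rankNumericalRange h α β hr hm

theorem eq_left_of_mem_rankNumericalRange {α β z : ℂ} {k : ℕ} (hk : m < k)
    (hz : z ∈ rankNumericalRange k (blockMatrix α β C D)) : z = α := by
  rw [mem_rankNumericalRange_blockMatrix_iff] at hz
  exact (sub_eq_zero.1 (hz.left_eq_zero (by rwa [finrank_euclideanSpace_fin]))).symm

theorem eq_right_of_mem_rankNumericalRange {α β z : ℂ} {k : ℕ} (hk : r < k)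
    (hz : z ∈ rankNumericalRange k (blockMatrix α β C D)) : z = β := by
  rw [rankNumericalRange_blockMatrix_swap] at hz
  exact eq_left_of_mem_rankNumericalRange hk hz

theorem left_mem_rankNumericalRange (α β : ℂ) {k : ℕ} (hk : k ≤ r) :
    α ∈ rankNumericalRange k (blockMatrix α β C D) := by
  rw [mem_rankNumericalRange_blockMatrix_iff, sub_self]
  exact HasIsotropic.of_left_eq_zero (by rwa [finrank_euclideanSpace_fin])

theorem right_mem_rankNumericalRange (α β : ℂ) {k : ℕ} (hk : k ≤ m) :
    β ∈ rankNumericalRange k (blockMatrix α β C D) := by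
  rw [rankNumericalRange_blockMatrix_swap]
  exact left_mem_rankNumericalRange β α hk

theorem add_rank_le_of_mem_rankNumericalRange {α : ℂ} {k : ℕ}
    (h : α ∈ rankNumericalRange k (blockMatrix α α C D)) : k + (C + Dᴴ).rank ≤ r + m := by
  rw [mem_rankNumericalRange_blockMatrix_iff, sub_self] at h
  have := h.add_finrank_range_le
  rwa [finrank_euclideanSpace_fin, finrank_euclideanSpace_fin, ← toEuclideanLin_conjTranspose,
    ← map_add, ← rank_eq_finrank_range_toEuclideanLin] at this

theorem RowPattern.mem_rankNumericalRange (h : RowPattern C D) (α : ℂ) {k : ℕ}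
    (hk : k + (C + Dᴴ).rank ≤ r + m) : α ∈ rankNumericalRange k (blockMatrix α α C D) := by
  obtain ⟨F, hF, hC, hD⟩ := h.exists_projection
  rw [mem_rankNumericalRange_blockMatrix_iff, sub_self]
  have := hasIsotropic_zero_zero (Matrix.toEuclideanLin F) (Matrix.toEuclideanLin (C + Dᴴ)) (k := k)
    (by rwa [finrank_euclideanSpace_fin, finrank_euclideanSpace_fin,
      ← rank_eq_finrank_range_toEuclideanLin])
  rwa [← toEuclideanLin_one_sub, ← toEuclideanLin_conjTranspose, ← toEuclideanLin_mul,
    ← toEuclideanLin_mul, ← hC, ← hD] at this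

theorem mem_rankNumericalRange_of_add_rank_le (h : RowPattern C D ∨ ColumnPattern C D) (α : ℂ)
    {k : ℕ} (hk : k + (C + Dᴴ).rank ≤ r + m) :
    α ∈ rankNumericalRange k (blockMatrix α α C D) := by
  rcases h with h | h
  · exact h.mem_rankNumericalRange α hk
  · rw [rankNumericalRange_blockMatrix_swap]
    refine h.swap.mem_rankNumericalRange α ?_
    rw [conjTranspose_add_conjTranspose, rank_eq_finrank_range_toEuclideanLin,
      toEuclideanLin_conjTranspose, LinearMap.finrank_range_adjoint,
      ← rank_eq_finrank_range_toEuclideanLin]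
    omega

end Patterns

end HigherRank

/-! ### Assembly of the cases -/

theorem corollary3p8 (r m : ℕ) (hr : 0 < r) (hm : 0 < m) (α β : ℂ)
    (C : Matrix (Fin r) (Fin m) ℂ) (D : Matrix (Fin m) (Fin r) ℂ)
    (hCD : HigherRank.RowPattern C D ∨ HigherRank.ColumnPattern C D)
    (A : Matrix (Fin r ⊕ Fin m) (Fin r ⊕ Fin m) ℂ)
    (hA : A = HigherRank.blockMatrix α β C D)
    (p : ℕ) (hp : p = (C + Dᴴ).rank) :
    (∀ k : ℕ, 1 ≤ k → k ≤ p →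
      HigherRank.rankNumericalRange k A =
        HigherRank.ellipticalDisc α β (HigherRank.singularValue (C + Dᴴ) k)) ∧
    HigherRank.numericalRange A = HigherRank.ellipticalDisc α β ‖C + Dᴴ‖ ∧
    (∀ k : ℕ, p < k → k ≤ min r m →
      HigherRank.rankNumericalRange k A = segment ℝ α β) ∧
    (∀ k : ℕ, m < k → k ≤ r → HigherRank.rankNumericalRange k A = {α}) ∧
    (∀ k : ℕ, r < k → k ≤ m → HigherRank.rankNumericalRange k A = {β}) ∧
    (∀ k : ℕ, max r m < k → k ≤ r + m → (α ≠ β ∨ r + m < k + p) →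
      HigherRank.rankNumericalRange k A = ∅) ∧
    (∀ k : ℕ, max r m < k → k + p ≤ r + m → α = β →
      HigherRank.rankNumericalRange k A = {α}) := by
  subst hA hp
  have hpr : (C + Dᴴ).rank ≤ r := by simpa using (C + Dᴴ).rank_le_card_height
  have hpm : (C + Dᴴ).rank ≤ m := by simpa using (C + Dᴴ).rank_le_card_width
  refine ⟨fun k hk hkp => ?_, ?_, fun k hk hkm => ?_, fun k hk hkr => ?_, fun k hk hkm => ?_,
    fun k hk hkn h => ?_, fun k hk hkn h => ?_⟩
  · exact HigherRank.rankNumericalRange_eq_ellipticalDisc hCD α β hk (hkp.trans hpr)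
      (hkp.trans hpm)
  · rw [HigherRank.numericalRange_eq_rankNumericalRange_one,
      HigherRank.norm_eq_singularValue_one hm]
    exact HigherRank.rankNumericalRange_eq_ellipticalDisc hCD α β le_rfl hr hm
  · rw [HigherRank.rankNumericalRange_eq_ellipticalDisc hCD α β (by omega)
      (hkm.trans (min_le_left _ _)) (hkm.trans (min_le_right _ _)),
      HigherRank.singularValue_eq_zero hk, HigherRank.ellipticalDisc_zero]
  · exact Set.Subset.antisymm
      (fun z hz => HigherRank.eq_left_of_mem_rankNumericalRange hk hz)
      (Set.singleton_subset_iff.2 (HigherRank.left_mem_rankNumericalRange α β hkr))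
  · exact Set.Subset.antisymm
      (fun z hz => HigherRank.eq_right_of_mem_rankNumericalRange hk hz)
      (Set.singleton_subset_iff.2 (HigherRank.right_mem_rankNumericalRange α β hkm))
  · rw [Set.eq_empty_iff_forall_notMem]
    intro z hz
    have h1 := HigherRank.eq_left_of_mem_rankNumericalRange ((le_max_right r m).trans_lt hk) hz
    have h2 := HigherRank.eq_right_of_mem_rankNumericalRange ((le_max_left r m).trans_lt hk) hz
    subst h1 h2
    have h3 := HigherRank.add_rank_le_of_mem_rankNumericalRange hz
    rcases h with h | h
    · exact h rfl
    · omega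
  · subst h
    exact Set.Subset.antisymm
      (fun z hz => HigherRank.eq_left_of_mem_rankNumericalRange
        ((le_max_right r m).trans_lt hk) hz)
      (Set.singleton_subset_iff.2
        (HigherRank.mem_rankNumericalRange_of_add_rank_le hCD α hkn))
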